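/- **Stochastic Lanczos quadrature (SLQ).** For a symmetric $A\in\mathbb R^{n\times n}$ with eigenvalues $\lambda_1(A),\dots,\lambda_n(A)$ let $s_A=\frac1n\sum_{i=1}^n\delta_{\lambda_i(A)}$ be its spectral density and $\|A\|_2$ its spectral norm. For probability distributions $\mu,\nu$ on $\mathbb R$ of bounded support let $W_1(\mu,\nu)=\sup_h\left(\int h\,d\mu-\int h\,d\nu\right)$, the supremum being over all $1$-Lipschitz $h:\mathbb R\to\mathbb R$. SLQ with $m\ge 1$ iterations accesses $A$ only through matrix-vector products. It draws $g$ uniformly from the unit sphere of $\mathbb R^n$ and runs the Lanczos algorithm: with $q_0=0$ and $\tilde q_1=g$, for $i=1,\dots,m$, $$\eta_{i-1}=\|\tilde q_i\|_2,\quad q_i=\tilde q_i/\eta_{i-1},\quad \alpha_i=q_i^TAq_i,\quad \tilde q_{i+1}=Aq_i-\alpha_iq_i-\eta_{i-1}q_{i-1},$$ where $q_i=0$ if $\tilde q_i=0$ (this only pads with zeros the matrix $T$ of the run that stops there, and does not change the output). Let $T\in\mathbb R^{m\times m}$ be the symmetric tridiagonal matrix with $T_{ii}=\alpha_i$ and $T_{i,i-1}=T_{i-1,i}=\eta_{i-1}$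 for $2\le i\le m$, with orthonormal eigenvectors $v_1,\dots,v_m$ and eigenvalues $\lambda_1(T),\dots,\lambda_m(T)$. The output is $f=\sum_{j=1}^m (v_j^Te_1)^2\,\delta_{\lambda_j(T)}$. **Theorem.** There is an absolute constant $c>0$, and for every $\varepsilon_0\in(0,1)$ there is a constant $C>0$ depending only on $\varepsilon_0$, such that the following holds for all $n\ge1$, all symmetric $A\in\mathbb R^{n\times n}$, all $\varepsilon\in(0,\varepsilon_0]$, all $\delta\in(0,1)$, and every integer $m\ge c/\varepsilon$ (in particular for $m=\lceil c/\varepsilon\rceil=O(1/\varepsilon)$). SLQ with $m$ iterations performs exactly $m$ matrix-vector products with $A$, and with probability at least $1-\delta$ its output $f$ satisfies $$W_1(s_A,f)\le \varepsilon\|A\|_2+\frac{C\log\left(\frac1{\varepsilon\delta}\right)\log\left(\frac1\varepsilon\right)}{\sqrt n}\,\|A\|_2 .$$ -/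

import Mathlib

open MeasureTheory

namespace SLQ

noncomputable section

/-- Real `n`-dimensional space with the Euclidean norm. -/
abbrev Vec (n : ℕ) : Type := EuclideanSpace ℝ (Fin n)

/-- The product `A x` of a matrix and a vector. -/
def matVec {n : ℕ} (A : Matrix (Fin n) (Fin n) ℝ) (x : Vec n) : Vec n :=
  Matrix.toEuclideanCLM (n := Fin n) (𝕜 := ℝ) A x

/-- The spectral norm of a matrix: the operator norm for the Euclidean norm. -/
def specNorm {n : ℕ} (A : Matrix (Fin n) (Fin n) ℝ) : ℝ :=
  ‖Matrix.toEuclideanCLM (n := Fin n) (𝕜 := ℝ) A‖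

/-! ### Algorithms in the matrix-vector query model

A program with results in `α` is given without reference to the matrix. It may access the matrix
only by asking for its product with a vector of its choice. -/

/-- Programs of the matrix-vector query model. -/
inductive Program (n : ℕ) (α : Type) : Type
  /-- Stop and return a result. -/
  | ret : α → Program n α
  /-- Ask for the product of the matrix with a vector, and continue with the answer. -/
  | query : Vec n → (Vec n → Program n α) → Program n α

namespace Program

variable {n : ℕ} {α β : Type}

/-- Apply a function to the result of a program. -/
def map (φ : α → β) : Program n α → Program n β
  | ret a => ret (φ a)
  | query x k => query x fun y => (k y).map φ

/-- The result of a program that is run on the matrix `A`. -/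
def output (A : Matrix (Fin n) (Fin n) ℝ) : Program n α → α
  | ret a => a
  | query x k => (k (matVec A x)).output A

/-- The number of matrix-vector products that a program performs when it is run on `A`. -/
def numQueries (A : Matrix (Fin n) (Fin n) ℝ) : Program n α → ℕ
  | ret _ => 0
  | query x k => (k (matVec A x)).numQueries A + 1

end Program

/-! ### The Lanczos algorithm -/

/-- What the `i`-th Lanczos iteration computes: the Lanczos vector `q = q_i` (the `i`-th column of
`Q`), the diagonal entry `diag = α_i` of `T`, and the norm `norm = η_{i-1}` of the unnormalised
vector, which for `2 ≤ i` is the entry of `T` at `(i, i - 1)` and `(i - 1, i)`. -/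
structure LanczosStep (n : ℕ) where
  q : Vec n
  diag : ℝ
  norm : ℝ

/-- `k` further Lanczos iterations, starting from the preceding Lanczos vector `qPrev = q_{i-1}` and
the unnormalised next vector `r = q̃_i`. One iteration computes `η_{i-1} = ‖q̃_i‖`,
`q_i = q̃_i / η_{i-1}`, `α_i = q_iᵀ A q_i` and `q̃_{i+1} = A q_i - α_i q_i - η_{i-1} q_{i-1}`,
with one matrix-vector product.

If `q̃_i = 0` (the Krylov subspace is exhausted), then with `0⁻¹ = 0` this iteration and all later
ones yield `q = 0`, `α = 0` and `η = 0`: the matrix `T` is the one of the run that stops at this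
point, padded with zeros. The padding is decoupled from the first basis vector. -/
def lanczosLoop {n : ℕ} : (k : ℕ) → (qPrev r : Vec n) → Program n (Fin k → LanczosStep n)
  | 0, _, _ => .ret Fin.elim0
  | k + 1, qPrev, r =>
    let η : ℝ := ‖r‖
    let q : Vec n := η⁻¹ • r
    .query q fun y =>
      let a : ℝ := inner ℝ q y
      (lanczosLoop k q (y - a • q - η • qPrev)).map
        (Fin.cons (α := fun _ => LanczosStep n) ⟨q, a, η⟩)

/-- The Lanczos algorithm with starting vector `g` and `m` iterations. -/
def lanczos {n : ℕ} (m : ℕ) (g : Vec n) : Program n (Fin m → LanczosStep n) :=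
  lanczosLoop m 0 g

/-- The symmetric tridiagonal matrix `T` of a run of the Lanczos algorithm. -/
def tridiag {n m : ℕ} (s : Fin m → LanczosStep n) : Matrix (Fin m) (Fin m) ℝ :=
  Matrix.of fun i j =>
    if i = j then (s i).diag
    else if (i : ℕ) = j + 1 then (s i).norm
    else if (j : ℕ) = i + 1 then (s j).norm
    else 0

theorem tridiag_isHermitian {n m : ℕ} (s : Fin m → LanczosStep n) : (tridiag s).IsHermitian := by
  ext i j
  simp only [tridiag, Matrix.conjTranspose_apply, Matrix.of_apply, star_trivial]
  grind

/-! ### Stochastic Lanczos quadrature -/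

/-- For a symmetric matrix `T` with orthonormal eigenvectors `v_j` and eigenvalues `λ_j`, the
distribution `∑ⱼ w_j² δ(x - λ_j)` with `w_j = v_jᵀ e₁`. -/
def quadrature {m : ℕ} [NeZero m] {T : Matrix (Fin m) (Fin m) ℝ} (hT : T.IsHermitian) : Measure ℝ :=
  ∑ j, ENNReal.ofReal (hT.eigenvectorBasis j 0 ^ 2) • Measure.dirac (hT.eigenvalues j)

/-- Stochastic Lanczos quadrature with `m` iterations, after the starting vector `g` is drawn. -/
def slq {n : ℕ} (m : ℕ) [NeZero m] (g : Vec n) : Program n (Measure ℝ) :=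
  (lanczos m g).map fun s => quadrature (tridiag_isHermitian s)

/-- The uniform distribution on the unit sphere of `ℝⁿ`: the surface measure, normalised. -/
def uniformSphere (n : ℕ) : Measure (Metric.sphere (0 : Vec n) 1) :=
  ((volume : Measure (Vec n)).toSphere Set.univ)⁻¹ • (volume : Measure (Vec n)).toSphere

/-! ### Spectral density and Wasserstein distance -/

/-- The spectral density of a symmetric matrix: mass `1 / n` at each of its `n` eigenvalues. -/
def spectralDensity {n : ℕ} {A : Matrix (Fin n) (Fin n) ℝ} (hA : A.IsHermitian) : Measure ℝ :=
  (n : ENNReal)⁻¹ • ∑ i, Measure.dirac (hA.eigenvalues i)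

/-- The Wasserstein-1 distance of two probability distributions of bounded support, in its dual
form: the supremum of `∫ h dμ - ∫ h dν` over all 1-Lipschitz functions `h`. (Negative values are cut
off at `0`, which does not change the supremum, since `h = 0` is admitted.) -/
def W1 (μ ν : Measure ℝ) : ENNReal :=
  ⨆ (h : ℝ → ℝ) (_ : LipschitzWith 1 h), ENNReal.ofReal ((∫ x, h x ∂μ) - ∫ x, h x ∂ν)

end

end SLQ

/-! Write `w_i = ⟨u_i, g⟩²` for the weights of `g` in an orthonormal eigenbasis of `A`. The measure
`∑ w_i δ(λ_i)` stands between the spectral density, which has weights `1/n`, and the output of SLQ.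

Lanczos to quadrature: `T` is the compression of `A` to the Lanczos vectors, and `⟨e₁, Tᵏ e₁⟩ = ⟨g,
Aᵏ g⟩` for `k < m`. So the output and the intermediate measure agree on polynomials of degree below
`m` (`sum_eigenvalues_tridiag_eval`), and both live on `[-‖A‖, ‖A‖]`. By Jackson's theorem a
1-Lipschitz function is within `π‖A‖/m` of such a polynomial there, which costs `2π‖A‖/m` in all.

Quadrature to spectral density: summation by parts along the sorted eigenvalues bounds the
difference of the integrals by `∑ d_k |∑_{i ∈ S_k} (w_i - 1/n)|`, where the gaps `d_k` add up to at
most `2‖A‖`. Gaps and sets depend on `A` alone, so a single event serves all test functions. Each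
inner sum is a trace-free quadratic form on the sphere, with bounded exponential moment at scale
`1/√n`; this follows from a Gaussian integral computed in polar coordinates. Convexity of `exp`
passes the moment bound to the weighted sum with no union bound, and Markov's inequality gives an
error of order `‖A‖ (1 + log (1/δ)) / √n`. The logarithms in the theorem dominate this because `log
(1/ε)` is bounded below. -/

namespace SLQ

/-! ### Running mapped programs -/

namespace Program

variable {n : ℕ} {α β : Type}

theorem output_map (A : Matrix (Fin n) (Fin n) ℝ) (φ : α → β) (p : Program n α) :
    (p.map φ).output A = φ (p.output A) := by
  induction p with
  | ret a => rfl
  | query x k ih => exact ih _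

theorem numQueries_map (A : Matrix (Fin n) (Fin n) ℝ) (φ : α → β) (p : Program n α) :
    (p.map φ).numQueries A = p.numQueries A := by
  induction p with
  | ret a => rfl
  | query x k ih => exact congrArg (· + 1) (ih _)

end Program

/-! ### Three-term recurrence and orthogonality of the Lanczos vectors (indices start at 0) -/

section Lanczos

variable {n : ℕ}

theorem numQueries_lanczosLoop (A : Matrix (Fin n) (Fin n) ℝ) (k : ℕ) (p r : Vec n) :
    (lanczosLoop k p r).numQueries A = k := by
  induction k generalizing p r with
  | zero => rfl
  | succ k ih =>
    simp only [lanczosLoop, Program.numQueries, Program.numQueries_map, ih]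

theorem numQueries_slq (A : Matrix (Fin n) (Fin n) ℝ) (m : ℕ) [NeZero m] (g : Vec n) :
    (slq m g).numQueries A = m := by
  rw [slq, Program.numQueries_map, lanczos, numQueries_lanczosLoop]

theorem inner_matVec_comm {A : Matrix (Fin n) (Fin n) ℝ} (hA : A.IsHermitian) (x y : Vec n) :
    inner ℝ x (matVec A y) = inner ℝ (matVec A x) y := by
  have h := Matrix.isSymmetric_toEuclideanLin_iff.2 hA
  exact (h x y).symm

theorem abs_inner_matVec_le (A : Matrix (Fin n) (Fin n) ℝ) (x : Vec n) :
    |inner ℝ x (matVec A x)| ≤ specNorm A * ‖x‖ ^ 2 := by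
  calc |inner ℝ x (matVec A x)| ≤ ‖x‖ * ‖matVec A x‖ := abs_real_inner_le_norm _ _
    _ ≤ ‖x‖ * (specNorm A * ‖x‖) := by
      gcongr
      exact ContinuousLinearMap.le_opNorm _ _
    _ = _ := by ring

theorem specNorm_nonneg (A : Matrix (Fin n) (Fin n) ℝ) : 0 ≤ specNorm A := norm_nonneg _

theorem matVec_eigenvectorBasis {A : Matrix (Fin n) (Fin n) ℝ} (hA : A.IsHermitian) (i : Fin n) :
    matVec A (hA.eigenvectorBasis i) = hA.eigenvalues i • hA.eigenvectorBasis i := by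
  ext j
  have := congrFun (hA.mulVec_eigenvectorBasis i) j
  simpa [matVec] using this

/-- A bound for the quadratic form bounds the eigenvalues. -/
theorem abs_eigenvalues_le {A : Matrix (Fin n) (Fin n) ℝ} (hA : A.IsHermitian) {R : ℝ}
    (hR : ∀ x, |inner ℝ x (matVec A x)| ≤ R * ‖x‖ ^ 2) (i : Fin n) : |hA.eigenvalues i| ≤ R := by
  have h := hR (hA.eigenvectorBasis i)
  rw [matVec_eigenvectorBasis, inner_smul_right, real_inner_self_eq_norm_sq,
    hA.eigenvectorBasis.norm_eq_one] at h
  simpa using h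

/-- Powers of a symmetric matrix in the spectral resolution. -/
theorem inner_iterate_matVec {A : Matrix (Fin n) (Fin n) ℝ} (hA : A.IsHermitian) (x : Vec n)
    (k : ℕ) : inner ℝ x ((matVec A)^[k] x) =
      ∑ i, inner ℝ (hA.eigenvectorBasis i) x ^ 2 * hA.eigenvalues i ^ k := by
  have key : ∀ i, inner ℝ (hA.eigenvectorBasis i) ((matVec A)^[k] x) =
      hA.eigenvalues i ^ k * inner ℝ (hA.eigenvectorBasis i) x := by
    intro i
    induction k with
    | zero => simp
    | succ k ih =>
      rw [Function.iterate_succ_apply', inner_matVec_comm hA, matVec_eigenvectorBasis,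
        real_inner_smul_left, ih]
      ring
  rw [← hA.eigenvectorBasis.sum_inner_mul_inner]
  refine Finset.sum_congr rfl fun i _ => ?_
  rw [key, real_inner_comm]
  ring

/-- One Lanczos iteration on the pair of the preceding Lanczos vector and the unnormalised next
vector. -/
noncomputable def lanczosNext (A : Matrix (Fin n) (Fin n) ℝ) (s : Vec n × Vec n) : Vec n × Vec n :=
  (‖s.2‖⁻¹ • s.2, matVec A (‖s.2‖⁻¹ • s.2) -
    (inner ℝ (‖s.2‖⁻¹ • s.2) (matVec A (‖s.2‖⁻¹ • s.2)) : ℝ) • (‖s.2‖⁻¹ • s.2) - ‖s.2‖ • s.1)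

/-- What a Lanczos iteration returns. -/
noncomputable def lanczosRecord (A : Matrix (Fin n) (Fin n) ℝ) (s : Vec n × Vec n) : LanczosStep n :=
  ⟨‖s.2‖⁻¹ • s.2, inner ℝ (‖s.2‖⁻¹ • s.2) (matVec A (‖s.2‖⁻¹ • s.2)), ‖s.2‖⟩

theorem output_lanczosLoop (A : Matrix (Fin n) (Fin n) ℝ) (k : ℕ) (p r : Vec n) (i : Fin k) :
    (lanczosLoop k p r).output A i = lanczosRecord A ((lanczosNext A)^[i] (p, r)) := by
  induction k generalizing p r with
  | zero => exact i.elim0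
  | succ k ih =>
    simp only [lanczosLoop, Program.output, Program.output_map]
    refine Fin.cases ?_ (fun j => ?_) i
    · rfl
    · rw [Fin.cons_succ, ih, Fin.val_succ, Function.iterate_succ_apply]
      rfl

/-- The infinite sequence of Lanczos iterations. -/
noncomputable def lanczosSeq (A : Matrix (Fin n) (Fin n) ℝ) (g : Vec n) (i : ℕ) : LanczosStep n :=
  lanczosRecord A ((lanczosNext A)^[i] (0, g))

theorem output_lanczos (A : Matrix (Fin n) (Fin n) ℝ) (m : ℕ) (g : Vec n) :
    (lanczos m g).output A = fun i : Fin m => lanczosSeq A g i := by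
  funext i
  exact output_lanczosLoop A m 0 g i

variable (A : Matrix (Fin n) (Fin n) ℝ) (g : Vec n)

theorem lanczosSeq_diag (i : ℕ) : (lanczosSeq A g i).diag =
    inner ℝ (lanczosSeq A g i).q (matVec A (lanczosSeq A g i).q) := rfl

theorem lanczosSeq_q_zero (hg : ‖g‖ = 1) : (lanczosSeq A g 0).q = g := by
  simp [lanczosSeq, lanczosRecord, hg]

theorem norm_smul_inv_norm_smul (r : Vec n) : ‖r‖ • (‖r‖⁻¹ • r) = r := by
  rcases eq_or_ne r 0 with rfl | h
  · simp
  · rw [smul_smul, mul_inv_cancel₀ (norm_ne_zero_iff.2 h), one_smul]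

theorem matVec_lanczosSeq_q_zero : matVec A (lanczosSeq A g 0).q =
    (lanczosSeq A g 0).diag • (lanczosSeq A g 0).q +
      (lanczosSeq A g 1).norm • (lanczosSeq A g 1).q := by
  have h : (lanczosSeq A g 1).norm • (lanczosSeq A g 1).q = _ := norm_smul_inv_norm_smul _
  rw [h]
  simp [lanczosSeq, lanczosRecord, lanczosNext]

/-- The three-term recurrence of the Lanczos vectors. -/
theorem matVec_lanczosSeq_q_succ (i : ℕ) : matVec A (lanczosSeq A g (i + 1)).q =
    (lanczosSeq A g (i + 1)).norm • (lanczosSeq A g i).q +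
    (lanczosSeq A g (i + 1)).diag • (lanczosSeq A g (i + 1)).q +
      (lanczosSeq A g (i + 2)).norm • (lanczosSeq A g (i + 2)).q := by
  have h : (lanczosSeq A g (i + 2)).norm • (lanczosSeq A g (i + 2)).q = _ :=
    norm_smul_inv_norm_smul _
  rw [h, Function.iterate_succ_apply']
  set s := (lanczosNext A)^[i + 1] (0, g) with hs
  have h1 : lanczosSeq A g (i + 1) = lanczosRecord A s := rfl
  have h2 : (lanczosSeq A g i).q = s.1 := by
    rw [hs, Function.iterate_succ_apply']
    rfl
  rw [h1, h2]
  simp only [lanczosNext, lanczosRecord]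
  abel

theorem lanczosSeq_norm_eq_zero_or (i : ℕ) :
    ((lanczosSeq A g i).norm = 0 ∧ (lanczosSeq A g i).q = 0) ∨ ‖(lanczosSeq A g i).q‖ = 1 := by
  simp only [lanczosSeq, lanczosRecord]
  set r := ((lanczosNext A)^[i] (0, g)).2
  rcases eq_or_ne r 0 with h | h
  · simp [h]
  · right
    rw [norm_smul, norm_inv, norm_norm, inv_mul_cancel₀ (norm_ne_zero_iff.2 h)]

/-- Breakdown persists: once the unnormalised vector is zero, every term of the next one vanishes,
the last because its factor is the norm of that zero vector. -/
theorem lanczosSeq_norm_succ_eq_zero {i : ℕ} (h : (lanczosSeq A g i).q = 0) :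
    (lanczosSeq A g (i + 1)).norm = 0 := by
  have h0 : ((lanczosNext A)^[i] (0, g)).2 = 0 := by
    have h' := norm_smul_inv_norm_smul ((lanczosNext A)^[i] (0, g)).2
    have h'' : ‖((lanczosNext A)^[i] (0, g)).2‖⁻¹ • ((lanczosNext A)^[i] (0, g)).2 = 0 := h
    rw [h'', smul_zero] at h'
    exact h'.symm
  simp [lanczosSeq, lanczosRecord, Function.iterate_succ_apply', lanczosNext, h0, matVec]

/-- This and the next two identities stand in for `⟨q, q⟩ = 1`. After a breakdown `q = 0`, but then
the coefficient in front is zero too. -/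
theorem lanczosSeq_norm_mul_inner_self (i : ℕ) : (lanczosSeq A g i).norm *
    inner ℝ (lanczosSeq A g i).q (lanczosSeq A g i).q = (lanczosSeq A g i).norm := by
  rcases lanczosSeq_norm_eq_zero_or A g i with h | h
  · simp [h.1]
  · simp [h]

theorem lanczosSeq_norm_succ_mul_inner_self (i : ℕ) : (lanczosSeq A g (i + 1)).norm *
    inner ℝ (lanczosSeq A g i).q (lanczosSeq A g i).q = (lanczosSeq A g (i + 1)).norm := by
  rcases lanczosSeq_norm_eq_zero_or A g i with h | h
  · simp [lanczosSeq_norm_succ_eq_zero A g h.2]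
  · simp [h]

theorem lanczosSeq_diag_mul_inner_self (i : ℕ) : (lanczosSeq A g i).diag *
    inner ℝ (lanczosSeq A g i).q (lanczosSeq A g i).q = (lanczosSeq A g i).diag := by
  rcases lanczosSeq_norm_eq_zero_or A g i with h | h
  · simp [lanczosSeq_diag, h.2]
  · simp [h]

variable {A}

/-- The Lanczos vectors are orthogonal. -/
theorem inner_lanczosSeq_q_of_lt (hA : A.IsHermitian) {i j : ℕ} (hij : i < j) :
    inner ℝ (lanczosSeq A g i).q (lanczosSeq A g j).q = 0 := by
  induction j using Nat.strong_induction_on generalizing i with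
  | _ j ih =>
  obtain ⟨j, rfl⟩ : ∃ k, j = k + 1 := ⟨j - 1, by omega⟩
  -- The recurrence only gives the inner product times the norm. If that norm is zero, the vector
  -- itself is zero.
  suffices h : (lanczosSeq A g (j + 1)).norm *
      inner ℝ (lanczosSeq A g i).q (lanczosSeq A g (j + 1)).q = 0 by
    rcases mul_eq_zero.1 h with h | h
    · rcases lanczosSeq_norm_eq_zero_or A g (j + 1) with h' | h'
      · rw [h'.2, inner_zero_right]
      · exfalso
        have h0 : (lanczosSeq A g (j + 1)).q =
          (lanczosSeq A g (j + 1)).norm⁻¹ • ((lanczosNext A)^[j + 1] (0, g)).2 := rfl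
        rw [h0, h] at h'
        simp at h'
    · exact h
  -- For `i < j`, expand both sides by the recurrence. The induction hypothesis removes the rest,
  -- except that for adjacent indices the same off-diagonal entry remains on both sides and cancels.
  have h1 : inner ℝ (lanczosSeq A g i).q (matVec A (lanczosSeq A g j).q) =
      inner ℝ (matVec A (lanczosSeq A g i).q) (lanczosSeq A g j).q := inner_matVec_comm hA _ _
  rcases Nat.lt_succ_iff_lt_or_eq.1 hij with hlt | rfl
  · obtain ⟨j, rfl⟩ : ∃ k, j = k + 1 := ⟨j - 1, by omega⟩
    rw [matVec_lanczosSeq_q_succ, inner_add_right, inner_add_right, real_inner_smul_right,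
      real_inner_smul_right, real_inner_smul_right, ih (j + 1) (by omega) hlt] at h1
    have h2 : inner ℝ (matVec A (lanczosSeq A g i).q) (lanczosSeq A g (j + 1)).q =
        (lanczosSeq A g (i + 1)).norm *
          inner ℝ (lanczosSeq A g (i + 1)).q (lanczosSeq A g (j + 1)).q := by
      rcases i with _ | i
      · rw [matVec_lanczosSeq_q_zero, inner_add_left, real_inner_smul_left, real_inner_smul_left,
          ih (j + 1) (by omega) hlt]
        ring
      · rw [matVec_lanczosSeq_q_succ, inner_add_left, inner_add_left, real_inner_smul_left,
          real_inner_smul_left, real_inner_smul_left, ih (j + 1) (by omega) hlt,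
          ih (j + 1) (by omega) (i := i) (by omega)]
        ring
    rw [h2] at h1
    rcases Nat.lt_succ_iff_lt_or_eq.1 hlt with hlt' | rfl
    · rw [ih j (by omega) hlt', ih (j + 1) (by omega) (i := i + 1) (by omega)] at h1
      linarith
    · rw [lanczosSeq_norm_mul_inner_self, lanczosSeq_norm_succ_mul_inner_self] at h1
      linarith
  -- For `i = j` the diagonal coefficient is exactly the one that removes the component along `q_i`.
  · have h3 := lanczosSeq_diag_mul_inner_self A g i
    rcases i with _ | i
    · have h4 := lanczosSeq_diag A g 0
      rw [matVec_lanczosSeq_q_zero, inner_add_right, real_inner_smul_right, real_inner_smul_right,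
        h3] at h4
      linarith
    · have h4 := lanczosSeq_diag A g (i + 1)
      rw [matVec_lanczosSeq_q_succ, inner_add_right, inner_add_right, real_inner_smul_right,
        real_inner_smul_right, real_inner_smul_right, h3, real_inner_comm,
        ih (i + 1) (by omega) (i := i) (by omega)] at h4
      linarith

theorem inner_lanczosSeq_q_of_ne (hA : A.IsHermitian) {i j : ℕ} (hij : i ≠ j) :
    inner ℝ (lanczosSeq A g i).q (lanczosSeq A g j).q = 0 := by
  rcases lt_or_gt_of_ne hij with h | h
  · exact inner_lanczosSeq_q_of_lt g hA h
  · rw [real_inner_comm]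
    exact inner_lanczosSeq_q_of_lt g hA h

end Lanczos

/-! ### Compression to the Krylov space and reproduction of moments -/

section Krylov

variable {n : ℕ} {A : Matrix (Fin n) (Fin n) ℝ} (hA : A.IsHermitian) (g : Vec n) (m : ℕ)

theorem matVec_apply {k : ℕ} (B : Matrix (Fin k) (Fin k) ℝ) (x : Vec k) (i : Fin k) :
    matVec B x i = ∑ j, B i j * x j := by
  simp [matVec, Matrix.mulVec, dotProduct]

theorem tridiag_lanczosSeq_apply (i j : Fin m) :
    tridiag (fun i : Fin m => lanczosSeq A g i) i j =
      if (i : ℕ) = j then (lanczosSeq A g i).diag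
      else if (i : ℕ) = j + 1 then (lanczosSeq A g i).norm
      else if (j : ℕ) = i + 1 then (lanczosSeq A g j).norm else 0 := by
  simp [tridiag, Fin.ext_iff]

include hA in
theorem inner_lanczosSeq_succ (j : ℕ) :
    inner ℝ (lanczosSeq A g (j + 1)).q (matVec A (lanczosSeq A g j).q) =
      (lanczosSeq A g (j + 1)).norm := by
  have h := lanczosSeq_norm_mul_inner_self A g (j + 1)
  rcases j with _ | j
  · rw [matVec_lanczosSeq_q_zero, inner_add_right, real_inner_smul_right, real_inner_smul_right, h,
      inner_lanczosSeq_q_of_ne g hA (by omega)]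
    ring
  · rw [matVec_lanczosSeq_q_succ, inner_add_right, inner_add_right, real_inner_smul_right,
      real_inner_smul_right, real_inner_smul_right, h, inner_lanczosSeq_q_of_ne g hA (by omega),
      inner_lanczosSeq_q_of_ne g hA (by omega)]
    ring

include hA in
theorem inner_lanczosSeq_of_lt {i j : ℕ} (hij : j + 1 < i) :
    inner ℝ (lanczosSeq A g i).q (matVec A (lanczosSeq A g j).q) = 0 := by
  rcases j with _ | j
  · rw [matVec_lanczosSeq_q_zero, inner_add_right, real_inner_smul_right, real_inner_smul_right,
      inner_lanczosSeq_q_of_ne g hA (by omega), inner_lanczosSeq_q_of_ne g hA (by omega)]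
    ring
  · rw [matVec_lanczosSeq_q_succ, inner_add_right, inner_add_right, real_inner_smul_right,
      real_inner_smul_right, real_inner_smul_right, inner_lanczosSeq_q_of_ne g hA (by omega),
      inner_lanczosSeq_q_of_ne g hA (by omega), inner_lanczosSeq_q_of_ne g hA (by omega)]
    ring

include hA in
/-- The tridiagonal matrix is the compression of `A` to the Lanczos vectors. -/
theorem tridiag_lanczosSeq_eq_inner (i j : Fin m) :
    tridiag (fun i : Fin m => lanczosSeq A g i) i j =
      inner ℝ (lanczosSeq A g i).q (matVec A (lanczosSeq A g j).q) := by
  rw [tridiag_lanczosSeq_apply]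
  have hcomm : inner ℝ (lanczosSeq A g i).q (matVec A (lanczosSeq A g j).q) =
      inner ℝ (lanczosSeq A g j).q (matVec A (lanczosSeq A g i).q) := by
    rw [inner_matVec_comm hA, real_inner_comm]
  split_ifs with h1 h2 h3
  · rw [h1]; rfl
  · rw [h2, inner_lanczosSeq_succ hA]
  · rw [hcomm, h3, inner_lanczosSeq_succ hA]
  · rcases lt_or_gt_of_ne h1 with h | h
    · rw [hcomm, inner_lanczosSeq_of_lt hA g (by omega)]
    · rw [inner_lanczosSeq_of_lt hA g (by omega)]

/-- The last column is excluded: there the recurrence has a further term along the Lanczos vector of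
index `m`, which `T` does not see. -/
theorem matVec_lanczosSeq_q_eq_sum (i : Fin m) (hi : (i : ℕ) + 1 < m) :
    matVec A (lanczosSeq A g i).q =
      ∑ j : Fin m, tridiag (fun i : Fin m => lanczosSeq A g i) j i • (lanczosSeq A g j).q := by
  obtain ⟨i, him⟩ := i
  simp only at hi ⊢
  have hterm : ∀ j : ℕ, ((if j = i then (lanczosSeq A g j).diag
      else if j = i + 1 then (lanczosSeq A g j).norm
      else if i = j + 1 then (lanczosSeq A g i).norm else 0) • (lanczosSeq A g j).q) =
      (if j = i then (lanczosSeq A g i).diag • (lanczosSeq A g i).q else 0) +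
      (if j = i + 1 then (lanczosSeq A g (i + 1)).norm • (lanczosSeq A g (i + 1)).q else 0) +
      (if j + 1 = i then (lanczosSeq A g i).norm • (lanczosSeq A g j).q else 0) := by
    intro j
    rcases eq_or_ne j i with rfl | h1
    · simp
    · rcases eq_or_ne j (i + 1) with rfl | h2
      · simp; omega
      · rcases eq_or_ne i (j + 1) with rfl | h3
        · simp [show j ≠ j + 1 + 1 by omega]
        · simp [h1, h2, h3, h3.symm]
  simp_rw [tridiag_lanczosSeq_apply, hterm]
  rw [Fin.sum_univ_eq_sum_range (fun j => (if j = i then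
      (lanczosSeq A g i).diag • (lanczosSeq A g i).q else 0) +
      (if j = i + 1 then (lanczosSeq A g (i + 1)).norm • (lanczosSeq A g (i + 1)).q else 0) +
      (if j + 1 = i then (lanczosSeq A g i).norm • (lanczosSeq A g j).q else 0)),
    Finset.sum_add_distrib, Finset.sum_add_distrib, Finset.sum_ite_eq', Finset.sum_ite_eq',
    if_pos (Finset.mem_range.2 him), if_pos (Finset.mem_range.2 hi)]
  rcases i with _ | i
  · rw [matVec_lanczosSeq_q_zero]
    simp
  · rw [matVec_lanczosSeq_q_succ]
    simp only [add_left_inj]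
    rw [Finset.sum_ite_eq', if_pos (Finset.mem_range.2 (by omega))]
    abel

/-- The linear combination of the first `m` Lanczos vectors with given coefficients. -/
noncomputable def lanczosComb (A : Matrix (Fin n) (Fin n) ℝ) (g : Vec n) (m : ℕ) (v : Vec m) :
    Vec n := ∑ i : Fin m, v i • (lanczosSeq A g i).q

theorem matVec_sum_smul {ι : Type*} (s : Finset ι) (c : ι → ℝ) (x : ι → Vec n) :
    matVec A (∑ i ∈ s, c i • x i) = ∑ i ∈ s, c i • matVec A (x i) := by
  simp [matVec, map_sum]

theorem matVec_lanczosComb (v : Vec m) (hv : ∀ i : Fin m, m ≤ (i : ℕ) + 1 → v i = 0) :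
    matVec A (lanczosComb A g m v) =
      lanczosComb A g m (matVec (tridiag fun i : Fin m => lanczosSeq A g i) v) := by
  simp only [lanczosComb, matVec_sum_smul, matVec_apply, Finset.sum_smul]
  rw [Finset.sum_comm]
  refine Finset.sum_congr rfl fun i _ => ?_
  by_cases hi : (i : ℕ) + 1 < m
  · rw [matVec_lanczosSeq_q_eq_sum g m i hi, Finset.smul_sum]
    refine Finset.sum_congr rfl fun j _ => ?_
    rw [smul_smul, mul_comm]
  · simp [hv i (by omega)]

/-- A tridiagonal matrix enlarges the support by at most one coordinate per multiplication. -/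
theorem iterate_matVec_tridiag_apply_eq_zero [NeZero m] (k : ℕ) (i : Fin m) (hi : k < i) :
    (matVec (tridiag fun i : Fin m => lanczosSeq A g i))^[k] (EuclideanSpace.single 0 1) i = 0 := by
  induction k generalizing i with
  | zero =>
    have : i ≠ 0 := fun h => by simp [h] at hi
    simp [this]
  | succ k ih =>
    rw [Function.iterate_succ_apply', matVec_apply]
    refine Finset.sum_eq_zero fun j _ => ?_
    by_cases hj : k < (j : ℕ)
    · rw [ih j hj, mul_zero]
    · rw [tridiag_lanczosSeq_apply, if_neg (by omega), if_neg (by omega), if_neg (by omega),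
        zero_mul]

/-- With `Q` the matrix of Lanczos vectors, `A Q v = Q T v` whenever the last coordinate of `v` is
zero. The powers `Tᵏ e₁` satisfy this as long as `k + 1 < m`. -/
theorem iterate_matVec_eq_lanczosComb [NeZero m] (hg : ‖g‖ = 1) (k : ℕ) (hk : k < m) :
    (matVec A)^[k] g = lanczosComb A g m
      ((matVec (tridiag fun i : Fin m => lanczosSeq A g i))^[k] (EuclideanSpace.single 0 1)) := by
  induction k with
  | zero =>
    simp [lanczosComb, ite_smul, lanczosSeq_q_zero A g hg]
  | succ k ih =>
    rw [Function.iterate_succ_apply', Function.iterate_succ_apply', ih (by omega),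
      matVec_lanczosComb]
    intro i hi
    exact iterate_matVec_tridiag_apply_eq_zero g m k i (by omega)

include hA in
theorem inner_lanczosComb [NeZero m] (hg : ‖g‖ = 1) (v : Vec m) :
    inner ℝ g (lanczosComb A g m v) = v 0 := by
  rw [lanczosComb, inner_sum, Finset.sum_eq_single 0]
  · simp [real_inner_smul_right, lanczosSeq_q_zero A g hg, hg]
  · intro j _ hj
    have hj' : (0 : ℕ) ≠ j := fun h => hj (Fin.ext (by simp [← h]))
    have h0 := inner_lanczosSeq_q_of_ne g hA hj'
    rw [lanczosSeq_q_zero A g hg] at h0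
    rw [real_inner_smul_right, h0, mul_zero]
  · simp

include hA in
-- Equality can fail, because the vectors after a breakdown are zero. The inequality is enough to
-- bound the quadratic form of `T` by that of `A`, hence to keep the quadrature nodes in `[-‖A‖,
-- ‖A‖]`.
theorem norm_lanczosComb_sq_le (v : Vec m) : ‖lanczosComb A g m v‖ ^ 2 ≤ ‖v‖ ^ 2 := by
  rw [← real_inner_self_eq_norm_sq, EuclideanSpace.real_norm_sq_eq, lanczosComb, sum_inner]
  refine Finset.sum_le_sum fun i _ => ?_
  rw [inner_sum, Finset.sum_eq_single i]
  · rw [real_inner_smul_left, real_inner_smul_right, real_inner_self_eq_norm_sq]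
    rcases lanczosSeq_norm_eq_zero_or A g i with h | h
    · simp [h.2, sq_nonneg]
    · rw [h]; apply le_of_eq; ring
  · intro j _ hj
    rw [real_inner_smul_left, real_inner_smul_right,
      inner_lanczosSeq_q_of_ne g hA (fun h => hj (Fin.ext h.symm))]
    ring
  · simp

include hA in
theorem inner_matVec_tridiag (v : Vec m) :
    inner ℝ v (matVec (tridiag fun i : Fin m => lanczosSeq A g i) v) =
      inner ℝ (lanczosComb A g m v) (matVec A (lanczosComb A g m v)) := by
  have h : inner ℝ (lanczosComb A g m v) (matVec A (lanczosComb A g m v)) =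
      ∑ i : Fin m, ∑ j : Fin m,
        v i * (v j * tridiag (fun i : Fin m => lanczosSeq A g i) i j) := by
    simp only [lanczosComb, matVec_sum_smul, sum_inner, inner_sum (𝕜 := ℝ), real_inner_smul_left,
      real_inner_smul_right, tridiag_lanczosSeq_eq_inner hA]
    rw [Finset.sum_comm]
    refine Finset.sum_congr rfl fun i _ => Finset.sum_congr rfl fun j _ => ?_
    ring
  rw [h]
  simp only [PiLp.inner_apply, matVec_apply, RCLike.inner_apply, conj_trivial, Finset.sum_mul]
  refine Finset.sum_congr rfl fun i _ => Finset.sum_congr rfl fun j _ => ?_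
  ring

include hA in
theorem abs_eigenvalues_tridiag_le (j : Fin m) :
    |(tridiag_isHermitian fun i : Fin m => lanczosSeq A g i).eigenvalues j| ≤ specNorm A := by
  refine abs_eigenvalues_le _ (fun v => ?_) j
  rw [inner_matVec_tridiag hA]
  refine (abs_inner_matVec_le _ _).trans ?_
  exact mul_le_mul_of_nonneg_left (norm_lanczosComb_sq_le hA g m v) (specNorm_nonneg A)

/-- Lanczos quadrature reproduces moments. -/
theorem sum_eigenvalues_tridiag_pow [NeZero m] (hg : ‖g‖ = 1) (k : ℕ) (hk : k < m) :
    ∑ j, (tridiag_isHermitian fun i : Fin m => lanczosSeq A g i).eigenvectorBasis j 0 ^ 2 *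
        (tridiag_isHermitian fun i : Fin m => lanczosSeq A g i).eigenvalues j ^ k =
      ∑ i, inner ℝ (hA.eigenvectorBasis i) g ^ 2 * hA.eigenvalues i ^ k := by
  rw [← inner_iterate_matVec hA, iterate_matVec_eq_lanczosComb g m hg k hk,
    inner_lanczosComb hA g m hg]
  have h := inner_iterate_matVec (tridiag_isHermitian fun i : Fin m => lanczosSeq A g i)
    (EuclideanSpace.single 0 1) k
  simp only [EuclideanSpace.inner_single_left, EuclideanSpace.inner_single_right, map_one, one_mul,
    conj_trivial] at h
  exact h.symm

theorem sum_eigenvalues_tridiag_eval [NeZero m] (hg : ‖g‖ = 1) (p : Polynomial ℝ)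
    (hp : p.natDegree < m) :
    ∑ j, (tridiag_isHermitian fun i : Fin m => lanczosSeq A g i).eigenvectorBasis j 0 ^ 2 *
        p.eval ((tridiag_isHermitian fun i : Fin m => lanczosSeq A g i).eigenvalues j) =
      ∑ i, inner ℝ (hA.eigenvectorBasis i) g ^ 2 * p.eval (hA.eigenvalues i) := by
  simp only [Polynomial.eval_eq_sum_range' hp, Finset.mul_sum]
  rw [Finset.sum_comm, Finset.sum_comm (s := Finset.univ (α := Fin n))]
  refine Finset.sum_congr rfl fun k hk => ?_
  have h := sum_eigenvalues_tridiag_pow hA g m hg k (Finset.mem_range.1 hk)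
  simp only [mul_left_comm _ (p.coeff k), ← Finset.mul_sum, h]

theorem sum_eigenvectorBasis_apply_sq [NeZero m] {T : Matrix (Fin m) (Fin m) ℝ}
    (hT : T.IsHermitian) : ∑ j, hT.eigenvectorBasis j 0 ^ 2 = 1 := by
  have h := inner_iterate_matVec hT (EuclideanSpace.single 0 1) 0
  simpa [EuclideanSpace.inner_single_right] using h.symm

theorem sum_inner_eigenvectorBasis_sq (x : Vec n) :
    ∑ i, inner ℝ (hA.eigenvectorBasis i) x ^ 2 = ‖x‖ ^ 2 := by
  have h := inner_iterate_matVec hA x 0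
  simpa using h.symm

theorem integral_quadrature [NeZero m] {T : Matrix (Fin m) (Fin m) ℝ} (hT : T.IsHermitian)
    (h : ℝ → ℝ) : ∫ x, h x ∂(quadrature hT) =
      ∑ j, hT.eigenvectorBasis j 0 ^ 2 * h (hT.eigenvalues j) := by
  rw [quadrature, integral_finsetSum_measure]
  · simp [integral_smul_measure, integral_dirac, ENNReal.toReal_ofReal, sq_nonneg]
  · intro i _
    exact (integrable_dirac (by simp)).smul_measure ENNReal.ofReal_ne_top

theorem integral_spectralDensity (h : ℝ → ℝ) : ∫ x, h x ∂(spectralDensity hA) =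
    ∑ i, (1 / n : ℝ) * h (hA.eigenvalues i) := by
  rw [spectralDensity, integral_smul_measure, integral_finsetSum_measure]
  · simp [integral_dirac, Finset.mul_sum]
  · intro i _
    exact integrable_dirac (by simp)

end Krylov

/-! ### Polynomial approximation of Lipschitz functions -/

section Jackson

open Real intervalIntegral

/-- The square modulus of the trigonometric polynomial with coefficients `sin (k π / M)`. -/
noncomputable def jacksonKernel (M : ℕ) (s : ℝ) : ℝ :=
  ∑ j ∈ Finset.range M, ∑ k ∈ Finset.range M,
    sin (j * (π / M)) * sin (k * (π / M)) * cos ((((j : ℤ) - k : ℤ) : ℝ) * s)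

/-- The sum of the squared coefficients. -/
noncomputable def jacksonMass (M : ℕ) : ℝ := ∑ j ∈ Finset.range M, sin (j * (π / M)) ^ 2

theorem jacksonMass_pos {M : ℕ} (hM : 2 ≤ M) : 0 < jacksonMass M := by
  refine Finset.sum_pos' (fun _ _ => sq_nonneg _) ⟨1, Finset.mem_range.2 (by omega), ?_⟩
  have hM' : (2 : ℝ) ≤ M := by exact_mod_cast hM
  have : 0 < sin (π / M) := by
    refine sin_pos_of_pos_of_lt_pi (by positivity) ?_
    rw [div_lt_iff₀ (by positivity)]
    nlinarith [pi_pos]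
  simp only [Nat.cast_one, one_mul]
  positivity

theorem jacksonKernel_nonneg (M : ℕ) (s : ℝ) : 0 ≤ jacksonKernel M s := by
  have h : jacksonKernel M s = (∑ j ∈ Finset.range M, sin (j * (π / M)) * cos (j * s)) ^ 2 +
      (∑ j ∈ Finset.range M, sin (j * (π / M)) * sin (j * s)) ^ 2 := by
    rw [jacksonKernel, sq, sq, Finset.sum_mul_sum, Finset.sum_mul_sum, ← Finset.sum_add_distrib]
    refine Finset.sum_congr rfl fun j _ => ?_
    rw [← Finset.sum_add_distrib]
    refine Finset.sum_congr rfl fun k _ => ?_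
    push_cast
    rw [sub_mul, cos_sub]
    ring
  rw [h]
  positivity

theorem continuous_jacksonKernel (M : ℕ) : Continuous (jacksonKernel M) := by
  unfold jacksonKernel
  fun_prop

theorem integral_cos_int_mul_sub (d : ℤ) (θ : ℝ) :
    ∫ t in (0 : ℝ)..2 * π, cos (d * (t - θ)) = if d = 0 then 2 * π else 0 := by
  split_ifs with hd
  · simp [hd]
  · have hd' : (d : ℝ) ≠ 0 := by exact_mod_cast hd
    have h : ∀ t : ℝ, cos (d * (t - θ)) = cos (d * t - d * θ) := fun t => by rw [mul_sub]
    simp_rw [h]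
    rw [integral_comp_mul_sub (f := fun x => cos x) hd', integral_cos]
    have : (d : ℝ) * (2 * π) - d * θ = d * 0 - d * θ + d * (2 * π) := by ring
    rw [this, sin_add_int_mul_two_pi, sub_self, smul_zero]

theorem integral_jacksonKernel (M : ℕ) (θ : ℝ) :
    ∫ t in (0 : ℝ)..2 * π, jacksonKernel M (t - θ) = 2 * π * jacksonMass M := by
  unfold jacksonKernel jacksonMass
  rw [integral_finsetSum (fun j _ => (by fun_prop : Continuous _).intervalIntegrable _ _),
    Finset.mul_sum]
  refine Finset.sum_congr rfl fun j hj => ?_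
  rw [integral_finsetSum (fun j _ => (by fun_prop : Continuous _).intervalIntegrable _ _)]
  simp_rw [intervalIntegral.integral_const_mul, integral_cos_int_mul_sub]
  rw [Finset.sum_eq_single_of_mem j hj]
  · simp; ring
  · intro k _ hk
    rw [if_neg (by omega), mul_zero]

/-- Multiplying by the cosine pairs neighbouring coefficients, and `sin ((j+1)b) + sin ((j-1)b) = 2
cos b sin (jb)`. For `b = π / M` the coefficients vanish at `0` and `M`, so there are no boundary
terms; this is the reason for the choice of coefficients. -/
theorem integral_cos_mul_jacksonKernel {M : ℕ} (hM : 2 ≤ M) (θ : ℝ) :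
    ∫ t in (0 : ℝ)..2 * π, cos (t - θ) * jacksonKernel M (t - θ) =
      2 * π * (cos (π / M) * jacksonMass M) := by
  have hM0 : (M : ℝ) ≠ 0 := by positivity
  unfold jacksonKernel jacksonMass
  simp_rw [Finset.mul_sum]
  rw [integral_finsetSum (fun j _ => (by fun_prop : Continuous _).intervalIntegrable _ _)]
  refine Finset.sum_congr rfl fun j hj => ?_
  rw [integral_finsetSum (fun j _ => (by fun_prop : Continuous _).intervalIntegrable _ _)]
  have h1 : ∀ k : ℕ, ∫ t in (0 : ℝ)..2 * π, cos (t - θ) * (sin (j * (π / M)) * sin (k * (π / M)) *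
      cos ((((j : ℤ) - k : ℤ) : ℝ) * (t - θ))) = sin (j * (π / M)) * π *
        ((if k = j + 1 then sin (k * (π / M)) else 0) +
          if k + 1 = j then sin (k * (π / M)) else 0) := by
    intro k
    have h2 : ∀ t : ℝ, cos (t - θ) * (sin (j * (π / M)) * sin (k * (π / M)) *
        cos ((((j : ℤ) - k : ℤ) : ℝ) * (t - θ))) =
        sin (j * (π / M)) * sin (k * (π / M)) / 2 *
          (cos ((((j : ℤ) - k + 1 : ℤ) : ℝ) * (t - θ)) +
            cos ((((j : ℤ) - k - 1 : ℤ) : ℝ) * (t - θ))) := by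
      intro t
      rw [Int.cast_add, Int.cast_sub _ 1, Int.cast_one, add_mul _ (1 : ℝ), sub_mul _ (1 : ℝ),
        one_mul, cos_add, cos_sub (_ * (t - θ))]
      ring
    simp_rw [h2]
    rw [intervalIntegral.integral_const_mul, intervalIntegral.integral_add
      ((by fun_prop : Continuous _).intervalIntegrable _ _)
      ((by fun_prop : Continuous _).intervalIntegrable _ _),
      integral_cos_int_mul_sub, integral_cos_int_mul_sub]
    have e1 : ((j : ℤ) - k + 1 = 0) ↔ k = j + 1 := by omega
    have e2 : ((j : ℤ) - k - 1 = 0) ↔ k + 1 = j := by omega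
    simp_rw [e1, e2]
    split_ifs <;> ring
  simp_rw [h1]
  rw [← Finset.mul_sum, Finset.sum_add_distrib, Finset.sum_ite_eq']
  -- The neighbour missing at the upper end would have coefficient `sin π = 0`.
  have h3 : (if j + 1 ∈ Finset.range M then sin (((j + 1 : ℕ) : ℝ) * (π / M)) else 0) =
      sin (((j : ℝ) + 1) * (π / M)) := by
    split_ifs with h
    · push_cast; rfl
    · have : (j : ℝ) + 1 = M := by
        have := Finset.mem_range.1 hj
        rw [Finset.mem_range] at h
        exact_mod_cast (by omega : j + 1 = M)
      rw [this, mul_div_cancel₀ _ hM0, sin_pi]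
  rw [h3]
  rcases j with _ | j
  · simp
  · simp only [add_left_inj]
    rw [Finset.sum_ite_eq', if_pos (Finset.mem_range.2 (by have := Finset.mem_range.1 hj; omega))]
    push_cast
    have e3 : ((j : ℝ) + 1 + 1) * (π / M) = (j + 1) * (π / M) + π / M := by ring
    have e4 : (j : ℝ) * (π / M) = (j + 1) * (π / M) - π / M := by ring
    rw [e3, e4, sin_add, sin_sub]
    ring

/-- With `u = |sin ((t - θ) / 2)|` the left side is at most `2u`, and `2u ≤ b/2 + 2u²/b` by AM-GM.
The right side has an exactly known average against the kernel, unlike the absolute value. -/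
theorem abs_cos_sub_cos_le {b : ℝ} (hb : 0 < b) (t θ : ℝ) :
    |cos t - cos θ| ≤ b / 2 + b⁻¹ * (1 - cos (t - θ)) := by
  rw [cos_sub_cos, abs_mul, abs_mul]
  have h1 : |sin ((t + θ) / 2)| ≤ 1 := abs_sin_le_one _
  have h2 : 1 - cos (t - θ) = 2 * |sin ((t - θ) / 2)| ^ 2 := by
    rw [sq_abs, sin_sq_eq_half_sub]
    ring_nf
  rw [h2]
  set u := |sin ((t - θ) / 2)|
  have hu : 0 ≤ u := abs_nonneg _
  have h3 : b / 2 + b⁻¹ * (2 * u ^ 2) - 2 * u = (b - 2 * u) ^ 2 / (2 * b) := by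
    field_simp
    ring
  have h4 : 0 ≤ (b - 2 * u) ^ 2 / (2 * b) := by positivity
  have h5 : |(-2 : ℝ)| = 2 := by norm_num
  rw [h5]
  nlinarith

theorem abs_integral_mul_jacksonKernel_sub_le {M : ℕ} (hM : 2 ≤ M) {f : ℝ → ℝ}
    (hf : LipschitzWith 1 f) (θ : ℝ) :
    |(∫ t in (0 : ℝ)..2 * π, f (cos t) * jacksonKernel M (t - θ)) -
      2 * π * jacksonMass M * f (cos θ)| ≤ 2 * π * jacksonMass M * (π / M) := by
  have hb : 0 < π / M := by positivity
  have hK := continuous_jacksonKernel M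
  have hfc := hf.continuous
  set b := π / M
  have e : (∫ t in (0 : ℝ)..2 * π, f (cos t) * jacksonKernel M (t - θ)) -
      2 * π * jacksonMass M * f (cos θ) =
      ∫ t in (0 : ℝ)..2 * π, (f (cos t) - f (cos θ)) * jacksonKernel M (t - θ) := by
    simp_rw [sub_mul]
    rw [intervalIntegral.integral_sub ((by fun_prop : Continuous _).intervalIntegrable _ _)
      ((by fun_prop : Continuous _).intervalIntegrable _ _), intervalIntegral.integral_const_mul,
      integral_jacksonKernel]
    ring
  have h2π : (0 : ℝ) ≤ 2 * π := by positivity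
  rw [e]
  calc |∫ t in (0 : ℝ)..2 * π, (f (cos t) - f (cos θ)) * jacksonKernel M (t - θ)|
      ≤ ∫ t in (0 : ℝ)..2 * π, |(f (cos t) - f (cos θ)) * jacksonKernel M (t - θ)| :=
        abs_integral_le_integral_abs h2π
    _ ≤ ∫ t in (0 : ℝ)..2 * π, ((b / 2 + b⁻¹) * jacksonKernel M (t - θ) -
          b⁻¹ * (cos (t - θ) * jacksonKernel M (t - θ))) := by
        refine integral_mono_on h2π ((by fun_prop : Continuous _).intervalIntegrable _ _)
          ((by fun_prop : Continuous _).intervalIntegrable _ _) fun t _ => ?_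
        rw [abs_mul, abs_of_nonneg (jacksonKernel_nonneg M _)]
        have h1 : |f (cos t) - f (cos θ)| ≤ |cos t - cos θ| := by
          simpa [Real.dist_eq] using hf.dist_le_mul (cos t) (cos θ)
        have h2 := mul_le_mul_of_nonneg_right (h1.trans (abs_cos_sub_cos_le hb t θ))
          (jacksonKernel_nonneg M (t - θ))
        linarith
    _ = 2 * π * jacksonMass M * (b / 2 + b⁻¹ * (1 - cos b)) := by
        rw [intervalIntegral.integral_sub ((by fun_prop : Continuous _).intervalIntegrable _ _)
          ((by fun_prop : Continuous _).intervalIntegrable _ _), intervalIntegral.integral_const_mul,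
          intervalIntegral.integral_const_mul, integral_jacksonKernel, integral_cos_mul_jacksonKernel hM]
        ring
    _ ≤ 2 * π * jacksonMass M * b := by
        have h3 := one_sub_sq_div_two_le_cos (x := b)
        have h4 : b⁻¹ * (1 - cos b) ≤ b⁻¹ * (b ^ 2 / 2) := by gcongr; linarith
        have h5 : b⁻¹ * (b ^ 2 / 2) = b / 2 := by field_simp
        have := jacksonMass_pos hM
        gcongr
        linarith

/-- **Jackson's theorem** for Lipschitz functions on `[-1, 1]`. -/
theorem exists_polynomial_abs_sub_le {M : ℕ} (hM : 2 ≤ M) {f : ℝ → ℝ} (hf : LipschitzWith 1 f) :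
    ∃ p : Polynomial ℝ, p.natDegree < M ∧
      ∀ x ∈ Set.Icc (-1 : ℝ) 1, |f x - p.eval x| ≤ π / M := by
  have hK := continuous_jacksonKernel M
  have hfc := hf.continuous
  have hm := jacksonMass_pos hM
  -- The normalised convolution of `f ∘ cos` with the kernel, keeping only its cosine part, so that
  -- it is a polynomial in `cos θ`. The frequencies satisfy `|j - k| < M`.
  let p : Polynomial ℝ := ∑ j ∈ Finset.range M, ∑ k ∈ Finset.range M,
    Polynomial.C ((2 * π * jacksonMass M)⁻¹ * (sin (j * (π / M)) * sin (k * (π / M)) *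
      ∫ t in (0 : ℝ)..2 * π, f (cos t) * cos ((((j : ℤ) - k : ℤ) : ℝ) * t))) *
        Polynomial.Chebyshev.T ℝ ((j : ℤ) - k)
  refine ⟨p, ?_, fun x hx => ?_⟩
  · rw [← Nat.le_sub_one_iff_lt (by omega)]
    refine Polynomial.natDegree_sum_le_of_forall_le _ _ fun j hj => ?_
    refine Polynomial.natDegree_sum_le_of_forall_le _ _ fun k hk => ?_
    refine (Polynomial.natDegree_C_mul_le _ _).trans ?_
    rw [Polynomial.Chebyshev.natDegree_T]
    rw [Finset.mem_range] at hj hk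
    omega
  · obtain ⟨θ, rfl⟩ : ∃ θ, cos θ = x := ⟨arccos x, cos_arccos hx.1 hx.2⟩
    -- Averaging the convolution over `θ` and `-θ` cancels the sine terms; the error bound is the
    -- same at both points.
    have hp : 2 * (2 * π * jacksonMass M) * p.eval (cos θ) =
        (∫ t in (0 : ℝ)..2 * π, f (cos t) * jacksonKernel M (t - θ)) +
        ∫ t in (0 : ℝ)..2 * π, f (cos t) * jacksonKernel M (t - -θ) := by
      rw [← intervalIntegral.integral_add ((by fun_prop : Continuous _).intervalIntegrable _ _)
        ((by fun_prop : Continuous _).intervalIntegrable _ _)]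
      have e : ∀ t, f (cos t) * jacksonKernel M (t - θ) + f (cos t) * jacksonKernel M (t - -θ) =
          ∑ j ∈ Finset.range M, ∑ k ∈ Finset.range M, (2 * (sin (j * (π / M)) *
            sin (k * (π / M))) * cos ((((j : ℤ) - k : ℤ) : ℝ) * θ)) *
              (f (cos t) * cos ((((j : ℤ) - k : ℤ) : ℝ) * t)) := by
        intro t
        simp only [jacksonKernel, Finset.mul_sum, ← Finset.sum_add_distrib]
        refine Finset.sum_congr rfl fun j _ => Finset.sum_congr rfl fun k _ => ?_
        rw [mul_sub, mul_sub, mul_neg, sub_neg_eq_add, cos_add, cos_sub]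
        ring
      simp_rw [e]
      rw [integral_finsetSum (fun j _ => (by fun_prop : Continuous _).intervalIntegrable _ _)]
      simp only [p, Polynomial.eval_finsetSum, Finset.mul_sum, Polynomial.eval_mul,
        Polynomial.eval_C, Polynomial.Chebyshev.T_real_cos]
      refine Finset.sum_congr rfl fun j _ => ?_
      rw [integral_finsetSum (fun j _ => (by fun_prop : Continuous _).intervalIntegrable _ _)]
      refine Finset.sum_congr rfl fun k _ => ?_
      rw [intervalIntegral.integral_const_mul]
      field_simp
    have h1 := abs_le.1 (abs_integral_mul_jacksonKernel_sub_le hM hf θ)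
    have h2 := abs_le.1 (abs_integral_mul_jacksonKernel_sub_le hM hf (-θ))
    rw [cos_neg] at h2
    have hc : 0 < 2 * (2 * π * jacksonMass M) := by positivity
    rw [← mul_le_mul_iff_of_pos_left hc]
    rw [← abs_of_pos hc, ← abs_mul, mul_sub, abs_of_pos hc, hp, abs_le]
    constructor <;> linarith [h1.1, h1.2, h2.1, h2.2]

/-- **Jackson's theorem** for Lipschitz functions on `[-R, R]`. -/
theorem exists_polynomial_abs_sub_le_mul {M : ℕ} (hM : 2 ≤ M) {f : ℝ → ℝ}
    (hf : LipschitzWith 1 f) {R : ℝ} (hR : 0 ≤ R) :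
    ∃ p : Polynomial ℝ, p.natDegree < M ∧ ∀ x, |x| ≤ R → |f x - p.eval x| ≤ R * (π / M) := by
  rcases hR.eq_or_lt with rfl | hR
  · refine ⟨Polynomial.C (f 0), by simp; omega, fun x hx => ?_⟩
    rw [abs_nonpos_iff.1 hx]
    simp
  · have hf' : LipschitzWith 1 fun x => R⁻¹ * f (R * x) := by
      refine LipschitzWith.of_dist_le_mul fun x y => ?_
      have h := hf.dist_le_mul (R * x) (R * y)
      rw [Real.dist_eq, Real.dist_eq, ← mul_sub, abs_mul, abs_of_pos hR] at h
      rw [Real.dist_eq, Real.dist_eq, ← mul_sub, abs_mul, abs_of_pos (inv_pos.2 hR),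
        inv_mul_le_iff₀ hR]
      simpa using h
    obtain ⟨p, hp, hpe⟩ := exists_polynomial_abs_sub_le hM hf'
    refine ⟨Polynomial.C R * p.comp (Polynomial.C R⁻¹ * Polynomial.X), ?_, fun x hx => ?_⟩
    · refine lt_of_le_of_lt ((Polynomial.natDegree_C_mul_le _ _).trans ?_) hp
      refine Polynomial.natDegree_comp_le.trans ?_
      have : (Polynomial.C R⁻¹ * Polynomial.X : Polynomial ℝ).natDegree ≤ 1 :=
        (Polynomial.natDegree_C_mul_le _ _).trans Polynomial.natDegree_X_le
      nlinarith
    · have h := hpe (R⁻¹ * x) (by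
        rw [Set.mem_Icc, ← abs_le, abs_mul, abs_of_pos (inv_pos.2 hR), inv_mul_le_iff₀ hR]
        simpa using hx)
      rw [mul_inv_cancel_left₀ hR.ne'] at h
      have h2 : f x - (Polynomial.C R * p.comp (Polynomial.C R⁻¹ * Polynomial.X)).eval x =
          R * (R⁻¹ * f x - p.eval (R⁻¹ * x)) := by
        simp [mul_sub, hR.ne']
      rw [h2, abs_mul, abs_of_pos hR]
      exact mul_le_mul_of_nonneg_left h hR.le

end Jackson

/-! ### Exponential moments of quadratic forms on the sphere -/

section Sphere

open Real Set

/-- Integration in polar coordinates. -/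
theorem lintegral_eq_lintegral_toSphere {n : ℕ} (hn : 1 ≤ n) {F : Vec n → ENNReal}
    (hF : Measurable F) : ∫⁻ x, F x = ∫⁻ g : Metric.sphere (0 : Vec n) 1,
      (∫⁻ r in Ioi (0 : ℝ), ENNReal.ofReal (r ^ (n - 1)) * F (r • (g : Vec n))) ∂(volume : Measure (Vec n)).toSphere := by
  have : NeZero n := ⟨by omega⟩
  have hdim : Module.finrank ℝ (Vec n) = n := by simp
  calc ∫⁻ x, F x = ∫⁻ x : ({(0)}ᶜ : Set (Vec n)), F x ∂((volume : Measure (Vec n)).comap (↑)) := by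
        rw [lintegral_subtype_comap (measurableSet_singleton _).compl, restrict_compl_singleton]
    _ = ∫⁻ x : ({(0)}ᶜ : Set (Vec n)), (fun y : Metric.sphere (0 : Vec n) 1 × Ioi (0 : ℝ) =>
          F ((y.2 : ℝ) • (y.1 : Vec n))) (homeomorphUnitSphereProd (Vec n) x)
            ∂((volume : Measure (Vec n)).comap (↑)) := by
        refine lintegral_congr fun x => ?_
        have h : ‖(x : Vec n)‖ ≠ 0 := norm_ne_zero_iff.2 x.2
        simp [homeomorphUnitSphereProd, smul_smul, h]
    _ = ∫⁻ y : Metric.sphere (0 : Vec n) 1 × Ioi (0 : ℝ), F ((y.2 : ℝ) • (y.1 : Vec n))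
          ∂((volume : Measure (Vec n)).toSphere.prod (.volumeIoiPow (n - 1))) := by
        have h := (volume : Measure (Vec n)).measurePreserving_homeomorphUnitSphereProd
        rw [hdim] at h
        exact h.lintegral_comp_emb (Homeomorph.measurableEmbedding _)
          fun y => F ((y.2 : ℝ) • (y.1 : Vec n))
    _ = ∫⁻ g : Metric.sphere (0 : Vec n) 1,
          (∫⁻ r : Ioi (0 : ℝ), F ((r : ℝ) • (g : Vec n)) ∂(.volumeIoiPow (n - 1)))
          ∂(volume : Measure (Vec n)).toSphere := by
        rw [lintegral_prod _ (by fun_prop)]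
    _ = _ := by
        refine lintegral_congr fun g => ?_
        rw [Measure.volumeIoiPow, lintegral_withDensity_eq_lintegral_mul _ (by fun_prop)
          (by fun_prop)]
        exact lintegral_subtype_comap measurableSet_Ioi
          (fun r : ℝ => ENNReal.ofReal (r ^ (n - 1)) * F (r • (g : Vec n)))

/-- A Gaussian integral that is diagonal in an orthonormal basis. -/
theorem lintegral_exp_neg_sum_mul_inner_sq {n : ℕ} (u : OrthonormalBasis (Fin n) ℝ (Vec n))
    {c : Fin n → ℝ} (hc : ∀ i, 0 < c i) :
    ∫⁻ x, ENNReal.ofReal (exp (-∑ i, c i * inner ℝ (u i) x ^ 2)) =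
      ENNReal.ofReal (∏ i, √(π / c i)) := by
  have h1 := (u.measurePreserving_repr).lintegral_comp
    (f := fun y : Vec n => ENNReal.ofReal (exp (-∑ i, c i * y i ^ 2))) (by fun_prop)
  have h2 := (EuclideanSpace.volume_preserving_symm_measurableEquiv_toLp (Fin n)).lintegral_comp
    (f := fun y : Fin n → ℝ => ENNReal.ofReal (exp (-∑ i, c i * y i ^ 2))) (by fun_prop)
  have h3 : ∀ y : Fin n → ℝ, exp (-∑ i, c i * y i ^ 2) = ∏ i, exp (-c i * y i ^ 2) := by
    intro y
    rw [← exp_sum, ← Finset.sum_neg_distrib]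
    simp
  have h4 : Integrable fun y : Fin n → ℝ => ∏ i, exp (-c i * y i ^ 2) :=
    Integrable.fintype_prod (f := fun i x => exp (-c i * x ^ 2))
      fun i => integrable_exp_neg_mul_sq (hc i)
  simp only [OrthonormalBasis.repr_apply_apply] at h1
  rw [h1]
  refine h2.trans ?_
  simp_rw [h3]
  rw [← ofReal_integral_eq_lintegral_ofReal h4
    (Filter.Eventually.of_forall fun y => Finset.prod_nonneg fun i _ => (exp_pos _).le),
    integral_fintype_prod_volume_eq_prod (fun i x => exp (-c i * x ^ 2))]
  simp_rw [integral_gaussian]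

theorem lintegral_rpow_mul_exp_neg {n : ℕ} (hn : 1 ≤ n) {b : ℝ} (hb : 0 < b) :
    ∫⁻ r in Ioi (0 : ℝ), ENNReal.ofReal (r ^ (n - 1)) * ENNReal.ofReal (exp (-(b * r ^ 2))) =
      ENNReal.ofReal (b ^ (-(n : ℝ) / 2)) * ENNReal.ofReal (1 / 2 * Gamma (n / 2)) := by
  have hn' : (1 : ℝ) ≤ n := by exact_mod_cast hn
  have h1 : ∀ r ∈ Ioi (0 : ℝ), ENNReal.ofReal (r ^ (n - 1)) * ENNReal.ofReal (exp (-(b * r ^ 2))) =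
      ENNReal.ofReal (r ^ ((n : ℝ) - 1) * exp (-b * r ^ (2 : ℝ))) := by
    intro r hr
    have hr' : (0 : ℝ) < r := hr
    rw [← ENNReal.ofReal_mul (by positivity)]
    congr 2
    · rw [← rpow_natCast, Nat.cast_sub hn, Nat.cast_one]
    · rw [rpow_two]; ring_nf
  rw [setLIntegral_congr_fun measurableSet_Ioi h1, ← ofReal_integral_eq_lintegral_ofReal
    (integrableOn_rpow_mul_exp_neg_mul_rpow (by linarith) two_pos hb)
    (by
      filter_upwards [ae_restrict_mem measurableSet_Ioi] with r hr
      have hr' : (0 : ℝ) < r := hr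
      positivity),
    integral_rpow_mul_exp_neg_mul_rpow two_pos (by linarith) hb, sub_add_cancel,
    ← ENNReal.ofReal_mul (by positivity), mul_assoc]

/-- Both sides are the integral of `exp (-∑ (1 - t_i) ⟨u_i, x⟩²)`: the right in coordinates, the
left in polar coordinates, where on each ray the exponent is `-(1 - ∑ t_i ⟨u_i, g⟩²) r²`. -/
theorem lintegral_toSphere_rpow {n : ℕ} (hn : 1 ≤ n) (u : OrthonormalBasis (Fin n) ℝ (Vec n))
    {t : Fin n → ℝ} (ht : ∀ i, t i < 1) :
    (∫⁻ g : Metric.sphere (0 : Vec n) 1,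
        ENNReal.ofReal ((1 - ∑ i, t i * inner ℝ (u i) (g : Vec n) ^ 2) ^ (-(n : ℝ) / 2))
          ∂(volume : Measure (Vec n)).toSphere) * ENNReal.ofReal (1 / 2 * Gamma (n / 2)) =
      ENNReal.ofReal (∏ i, √(π / (1 - t i))) := by
  rw [← lintegral_exp_neg_sum_mul_inner_sq u (fun i => sub_pos.2 (ht i)),
    lintegral_eq_lintegral_toSphere hn (by fun_prop), ← lintegral_mul_const' _ _ ENNReal.ofReal_ne_top]
  refine lintegral_congr fun g => ?_
  have hg : ∑ i, inner ℝ (u i) (g : Vec n) ^ 2 = 1 := by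
    have h := u.sum_sq_inner_right (g : Vec n)
    simpa using h
  have hb : 0 < 1 - ∑ i, t i * inner ℝ (u i) (g : Vec n) ^ 2 := by
    have h1 : 1 - ∑ i, t i * inner ℝ (u i) (g : Vec n) ^ 2 =
        ∑ i, (1 - t i) * inner ℝ (u i) (g : Vec n) ^ 2 := by
      simp only [sub_mul, one_mul, Finset.sum_sub_distrib, hg]
    rw [h1]
    have hnn : ∀ i ∈ Finset.univ, 0 ≤ (1 - t i) * inner ℝ (u i) (g : Vec n) ^ 2 := fun i _ =>
      mul_nonneg (sub_pos.2 (ht i)).le (sq_nonneg _)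
    refine lt_of_le_of_ne (Finset.sum_nonneg hnn) fun h => ?_
    have h2 := (Finset.sum_eq_zero_iff_of_nonneg hnn).1 h.symm
    have h3 : ∑ i, inner ℝ (u i) (g : Vec n) ^ 2 = 0 := Finset.sum_eq_zero fun i hi =>
      (mul_eq_zero.1 (h2 i hi)).resolve_left (sub_pos.2 (ht i)).ne'
    linarith
  rw [← lintegral_rpow_mul_exp_neg hn hb]
  refine lintegral_congr fun r => ?_
  congr 3
  simp only [inner_smul_right, mul_pow, sub_mul, one_mul, Finset.sum_sub_distrib, Finset.sum_mul]
  rw [neg_inj, ← Finset.mul_sum, hg, mul_one]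
  congr 1
  exact Finset.sum_congr rfl fun i _ => by ring

instance isProbabilityMeasure_uniformSphere {n : ℕ} [NeZero n] :
    IsProbabilityMeasure (uniformSphere n) := by
  have : Nontrivial (Vec n) := inferInstance
  refine ⟨?_⟩
  rw [uniformSphere, Measure.smul_apply, smul_eq_mul, ENNReal.inv_mul_cancel]
  · rw [Ne, Measure.measure_univ_eq_zero]
    exact Measure.toSphere_ne_zero _
  · exact measure_ne_top _ _

/-- The law of a quadratic form on the sphere. -/
theorem lintegral_uniformSphere_rpow {n : ℕ} (hn : 1 ≤ n)
    (u : OrthonormalBasis (Fin n) ℝ (Vec n)) {t : Fin n → ℝ} (ht : ∀ i, t i < 1) :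
    ∫⁻ g : Metric.sphere (0 : Vec n) 1,
        ENNReal.ofReal ((1 - ∑ i, t i * inner ℝ (u i) (g : Vec n) ^ 2) ^ (-(n : ℝ) / 2))
          ∂uniformSphere n = ENNReal.ofReal (∏ i, √(1 - t i)⁻¹) := by
  -- The case `t = 0` gives the total surface measure, so normalising cancels the Gamma factor and
  -- the powers of `π`.
  have h0 := lintegral_toSphere_rpow hn u (t := 0) (by simp)
  have h1 := lintegral_toSphere_rpow hn u ht
  have hn' : (1 : ℝ) ≤ n := by exact_mod_cast hn
  have hG : 0 < 1 / 2 * Gamma ((n : ℝ) / 2) := by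
    have := Gamma_pos_of_pos (s := (n : ℝ) / 2) (by linarith)
    positivity
  simp only [Pi.zero_apply, zero_mul, Finset.sum_const_zero, sub_zero, one_rpow, ENNReal.ofReal_one,
    lintegral_const, one_mul, div_one] at h0
  have h2 : ∏ i, √(π / (1 - t i)) = (∏ i : Fin n, √π) * ∏ i, √(1 - t i)⁻¹ := by
    rw [← Finset.prod_mul_distrib]
    refine Finset.prod_congr rfl fun i _ => ?_
    rw [div_eq_mul_inv, sqrt_mul pi_pos.le]
  have : NeZero n := ⟨by omega⟩
  have hS0 : (volume : Measure (Vec n)).toSphere univ ≠ 0 := by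
    rw [Ne, Measure.measure_univ_eq_zero]
    exact Measure.toSphere_ne_zero _
  have hS1 : (volume : Measure (Vec n)).toSphere univ ≠ ⊤ := measure_ne_top _ _
  rw [h2, ENNReal.ofReal_mul (Finset.prod_nonneg fun _ _ => sqrt_nonneg _), ← h0,
    mul_right_comm] at h1
  have h3 := (ENNReal.mul_left_inj (by simpa using hG) ENNReal.ofReal_ne_top).1 h1
  rw [uniformSphere, lintegral_smul_measure, h3, smul_eq_mul, ← mul_assoc,
    ENNReal.inv_mul_cancel hS0 hS1, one_mul]

/-- The linear term is kept exact so that it cancels when the `t_i` sum to zero, leaving only `∑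
t_i²`. -/
theorem sqrt_inv_one_sub_le {t : ℝ} (ht : t ≤ 1 / 2) : √(1 - t)⁻¹ ≤ exp (t / 2 + t ^ 2) := by
  rw [sqrt_le_left (exp_pos _).le, ← exp_nat_mul]
  have h0 : 0 < 1 - t := by linarith
  have h1 : (1 - t)⁻¹ = t / (1 - t) + 1 := by field_simp; ring
  have h2 : t / (1 - t) ≤ t + 2 * t ^ 2 := by
    rw [div_le_iff₀ h0]
    nlinarith [mul_nonneg (sq_nonneg t) (by linarith : (0 : ℝ) ≤ 1 - 2 * t)]
  rw [h1]
  refine (add_one_le_exp _).trans (exp_le_exp.2 (h2.trans_eq ?_))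
  push_cast
  ring

/-- Subgaussian bound for a trace-free quadratic form on the sphere. -/
theorem lintegral_uniformSphere_exp_le {n : ℕ} (hn : 1 ≤ n)
    (u : OrthonormalBasis (Fin n) ℝ (Vec n)) {t : Fin n → ℝ} (ht : ∀ i, t i ≤ 1 / 2)
    (hsum : ∑ i, t i = 0) :
    ∫⁻ g : Metric.sphere (0 : Vec n) 1,
        ENNReal.ofReal (exp (n / 2 * ∑ i, t i * inner ℝ (u i) (g : Vec n) ^ 2))
          ∂uniformSphere n ≤ ENNReal.ofReal (exp (∑ i, t i ^ 2)) := by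
  have h1 := lintegral_uniformSphere_rpow hn u (fun i => lt_of_le_of_lt (ht i) (by norm_num))
  have h2 : ∏ i, √(1 - t i)⁻¹ ≤ exp (∑ i, t i ^ 2) := by
    calc ∏ i, √(1 - t i)⁻¹ ≤ ∏ i, exp (t i / 2 + t i ^ 2) :=
          Finset.prod_le_prod (fun _ _ => sqrt_nonneg _) fun i _ => sqrt_inv_one_sub_le (ht i)
      _ = exp (∑ i, t i ^ 2) := by
          rw [← exp_sum, Finset.sum_add_distrib, ← Finset.sum_div, hsum, zero_div, zero_add]
  refine le_trans (lintegral_mono fun g => ENNReal.ofReal_le_ofReal ?_)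
    (h1.le.trans (ENNReal.ofReal_le_ofReal h2))
  have hg : ∑ i, inner ℝ (u i) (g : Vec n) ^ 2 = 1 := by
    have h := u.sum_sq_inner_right (g : Vec n)
    simpa using h
  set Q := ∑ i, t i * inner ℝ (u i) (g : Vec n) ^ 2 with hQ
  have hQ1 : Q ≤ 1 / 2 := by
    calc Q ≤ ∑ i, 1 / 2 * inner ℝ (u i) (g : Vec n) ^ 2 :=
          Finset.sum_le_sum fun i _ => mul_le_mul_of_nonneg_right (ht i) (sq_nonneg _)
      _ = 1 / 2 := by rw [← Finset.mul_sum, hg, mul_one]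
  have h0 : 0 < 1 - Q := by linarith
  rw [rpow_def_of_pos h0, exp_le_exp]
  -- This is `exp (nQ/2) ≤ (1 - Q)^(-n/2)`, whose right side has a known integral.
  have h3 : log (1 - Q) ≤ -Q := by linarith [log_le_sub_one_of_pos h0]
  have hn0 : (0 : ℝ) ≤ n := Nat.cast_nonneg n
  nlinarith

/-- The deviation of the weight that a point of the sphere gives to a set of coordinates. -/
noncomputable def weightDev {n : ℕ} (u : OrthonormalBasis (Fin n) ℝ (Vec n)) (S : Finset (Fin n))
    (g : Vec n) : ℝ := ∑ i ∈ S, (inner ℝ (u i) g ^ 2 - 1 / n)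

theorem measurable_weightDev {n : ℕ} (u : OrthonormalBasis (Fin n) ℝ (Vec n))
    (S : Finset (Fin n)) : Measurable (weightDev u S) := by
  unfold weightDev
  fun_prop

theorem lintegral_uniformSphere_exp_weightDev_le {n : ℕ} (hn : 1 ≤ n)
    (u : OrthonormalBasis (Fin n) ℝ (Vec n)) (S : Finset (Fin n)) {τ : ℝ} (hτ : |τ| ≤ 1) :
    ∫⁻ g : Metric.sphere (0 : Vec n) 1,
        ENNReal.ofReal (exp (τ * (√n / 4 * weightDev u S g))) ∂uniformSphere n ≤
      ENNReal.ofReal (exp (1 / 4)) := by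
  have hn' : (1 : ℝ) ≤ n := by exact_mod_cast hn
  have hs1 : 1 ≤ √(n : ℝ) := one_le_sqrt.2 hn'
  have hs : √(n : ℝ) * √n = n := mul_self_sqrt (by linarith)
  obtain ⟨hτ1, hτ2⟩ := abs_le.1 hτ
  have hcard : (S.card : ℝ) ≤ n := by
    exact_mod_cast (S.card_le_univ.trans_eq (Fintype.card_fin n))
  -- The deviation is the quadratic form of the indicator of `S` minus its mean. Scaled by `τ /
  -- (2√n)`, the coefficients have squares summing to at most `1/4`, for every `S`.
  let b : Fin n → ℝ := fun i => (if i ∈ S then 1 else 0) - S.card / n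
  have hb : ∀ i, |b i| ≤ 1 := by
    intro i
    have h1 : (S.card : ℝ) / n ≤ 1 := (div_le_one (by linarith)).2 hcard
    have h2 : (0 : ℝ) ≤ S.card / n := by positivity
    simp only [b]
    rw [abs_le]
    split_ifs <;> constructor <;> linarith
  have habs : ∀ i, |τ / (2 * √n) * b i| ≤ 1 / (2 * √n) := by
    intro i
    rw [abs_mul, abs_div, abs_of_pos (by positivity : 0 < 2 * √(n : ℝ))]
    calc |τ| / (2 * √n) * |b i| ≤ 1 / (2 * √n) * 1 := by gcongr; exact hb i
      _ = _ := mul_one _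
  have h := lintegral_uniformSphere_exp_le hn u (t := fun i => τ / (2 * √n) * b i) (fun i => ?_) ?_
  · refine le_trans (lintegral_mono fun g => ?_) (h.trans (ENNReal.ofReal_le_ofReal ?_))
    · refine le_of_eq ?_
      have hg : ∑ i, inner ℝ (u i) (g : Vec n) ^ 2 = 1 := by
        have h := u.sum_sq_inner_right (g : Vec n)
        simpa using h
      have h2 : ∑ i, b i * inner ℝ (u i) (g : Vec n) ^ 2 = weightDev u S g := by
        simp only [b, weightDev, sub_mul, Finset.sum_sub_distrib, ← Finset.mul_sum, hg, ite_mul,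
          one_mul, zero_mul, Finset.sum_ite_mem, Finset.univ_inter, Finset.sum_const, nsmul_eq_mul]
        ring
      simp only [mul_assoc, ← Finset.mul_sum, h2]
      congr 2
      nth_rewrite 2 [← hs]
      field_simp
      ring
    · refine exp_le_exp.2 ?_
      calc ∑ i, (τ / (2 * √n) * b i) ^ 2 ≤ ∑ _i : Fin n, (1 / (2 * √n)) ^ 2 := by
            refine Finset.sum_le_sum fun i _ => ?_
            rw [← sq_abs]
            exact pow_le_pow_left₀ (abs_nonneg _) (habs i) 2
        _ = 1 / 4 := by
            rw [Finset.sum_const, Finset.card_univ, Fintype.card_fin, nsmul_eq_mul, div_pow,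
              mul_pow, sq_sqrt (by linarith)]
            field_simp
            norm_num
  · refine (le_abs_self _).trans ((habs i).trans ?_)
    exact one_div_le_one_div_of_le two_pos (by linarith)
  · rw [← Finset.mul_sum]
    have : ∑ i, b i = 0 := by
      simp only [b, Finset.sum_sub_distrib, Finset.sum_ite_mem, Finset.univ_inter, Finset.sum_const,
        Finset.card_univ, Fintype.card_fin, nsmul_eq_mul]
      field_simp
      ring
    rw [this, mul_zero]

theorem lintegral_uniformSphere_exp_abs_weightDev_le {n : ℕ} (hn : 1 ≤ n)
    (u : OrthonormalBasis (Fin n) ℝ (Vec n)) (S : Finset (Fin n)) :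
    ∫⁻ g : Metric.sphere (0 : Vec n) 1,
        ENNReal.ofReal (exp (√n / 4 * |weightDev u S g|)) ∂uniformSphere n ≤
      ENNReal.ofReal (2 * exp (1 / 4)) := by
  have hm := measurable_weightDev u S
  have h1 := lintegral_uniformSphere_exp_weightDev_le hn u S (τ := 1) (by simp)
  have h2 := lintegral_uniformSphere_exp_weightDev_le hn u S (τ := -1) (by simp)
  rw [two_mul, ENNReal.ofReal_add (exp_pos _).le (exp_pos _).le]
  refine le_trans ?_ (add_le_add h1 h2)
  rw [← lintegral_add_left (by fun_prop)]
  refine lintegral_mono fun g => ?_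
  rw [← ENNReal.ofReal_add (exp_pos _).le (exp_pos _).le]
  refine ENNReal.ofReal_le_ofReal ?_
  rcases abs_cases (weightDev u S (g : Vec n)) with ⟨h, _⟩ | ⟨h, _⟩ <;> rw [h]
  · rw [one_mul]
    linarith [exp_pos (-1 * (√n / 4 * weightDev u S (g : Vec n)))]
  · rw [mul_neg, neg_one_mul]
    linarith [exp_pos (1 * (√n / 4 * weightDev u S (g : Vec n)))]

end Sphere

/-! ### From weight deviations to the Wasserstein distance -/

section Transport

open Real

/-- Summation by parts along sorted nodes, with increments that do not depend on the function. -/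
theorem exists_sum_mul_lipschitz_le {n : ℕ} (l : Fin n → ℝ) {R : ℝ} (hR : 0 ≤ R)
    (hl : ∀ i, |l i| ≤ R) :
    ∃ (S : ℕ → Finset (Fin n)) (d : ℕ → ℝ), (∀ k, 0 ≤ d k) ∧
      ∑ k ∈ Finset.range (n - 1), d k ≤ 2 * R ∧
      ∀ w : Fin n → ℝ, ∑ i, w i = 0 → ∀ h : ℝ → ℝ, LipschitzWith 1 h →
        |∑ i, w i * h (l i)| ≤ ∑ k ∈ Finset.range (n - 1), d k * |∑ i ∈ S k, w i| := by
  rcases Nat.eq_zero_or_pos n with rfl | hn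
  · exact ⟨fun _ => ∅, 0, by simp, by simpa using hR, by simp⟩
  let σ := Tuple.sort l
  have hσ : Monotone (l ∘ σ) := Tuple.monotone_sort l
  let y : ℕ → ℝ := fun k => if hk : k < n then l (σ ⟨k, hk⟩) else 0
  have hyσ : ∀ k : Fin n, y k = l (σ k) := fun k => by simp [y]
  -- `S k` holds the indices of the `k + 1` smallest nodes and `d k` is the gap above them; the gaps
  -- telescope.
  refine ⟨fun k => Finset.univ.filter fun i => (σ.symm i : ℕ) < k + 1,
    fun k => |y (k + 1) - y k|, fun k => abs_nonneg _, ?_, fun w hw h hh => ?_⟩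
  · have h1 : ∑ k ∈ Finset.range (n - 1), |y (k + 1) - y k| =
        ∑ k ∈ Finset.range (n - 1), (y (k + 1) - y k) := by
      refine Finset.sum_congr rfl fun k hk => abs_of_nonneg ?_
      rw [Finset.mem_range] at hk
      have h2 := hσ (show (⟨k, by omega⟩ : Fin n) ≤ ⟨k + 1, by omega⟩ by
        rw [Fin.le_def]; exact Nat.le_succ k)
      have h3 : k < n := by omega
      have h4 : k + 1 < n := by omega
      simp only [y, dif_pos h3, dif_pos h4]
      exact sub_nonneg.2 h2
    rw [h1, Finset.sum_range_sub]
    have h2 := abs_le.1 (hl (σ ⟨n - 1, by omega⟩))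
    have h3 := abs_le.1 (hl (σ ⟨0, hn⟩))
    rw [← hyσ] at h2 h3
    simp only at h2 h3
    linarith [h2.2, h3.1]
  · let v : ℕ → ℝ := fun k => if hk : k < n then w (σ ⟨k, hk⟩) else 0
    have hG : ∀ k, ∑ j ∈ Finset.range k, v j =
        ∑ i ∈ Finset.univ.filter fun i => (σ.symm i : ℕ) < k, w i := by
      intro k
      symm
      refine Finset.sum_bij_ne_zero (fun i _ _ => (σ.symm i : ℕ)) ?_ ?_ ?_ ?_
      · intro i hi _
        simpa using hi
      · intro i _ _ j _ _ hij
        exact σ.symm.injective (Fin.ext hij)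
      · intro j hj hv
        by_cases hjn : j < n
        · refine ⟨σ ⟨j, hjn⟩, by simpa using hj, ?_, by simp⟩
          simpa [v, hjn] using hv
        · simp [v, hjn] at hv
      · intro i _ _
        simp [v]
    have h1 : ∑ i, w i * h (l i) = ∑ k ∈ Finset.range n, h (y k) • v k := by
      rw [← Equiv.sum_comp σ, ← Fin.sum_univ_eq_sum_range (fun k => h (y k) • v k)]
      refine Finset.sum_congr rfl fun k _ => ?_
      rw [hyσ, smul_eq_mul, mul_comm]
      simp [v]
    have h2 : ∑ k ∈ Finset.range n, v k = 0 := by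
      rw [hG, Finset.filter_true_of_mem fun i _ => (σ.symm i).2, hw]
    -- The boundary term drops out because the weights sum to zero.
    rw [h1, Finset.sum_range_by_parts, h2, smul_zero, zero_sub, abs_neg]
    refine (Finset.abs_sum_le_sum_abs _ _).trans (Finset.sum_le_sum fun k _ => ?_)
    rw [smul_eq_mul, abs_mul, hG]
    refine mul_le_mul_of_nonneg_right ?_ (abs_nonneg _)
    simpa [Real.dist_eq] using hh.dist_le_mul (y (k + 1)) (y k)

theorem two_mul_exp_quarter_le : 2 * exp (1 / 4) ≤ exp 1 := by
  have h : (2 : ℝ) = exp (log 2) := (exp_log two_pos).symm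
  rw [h, ← exp_add]
  exact exp_le_exp.2 (by linarith [log_two_lt_d9])

/-- Jensen's inequality for `exp`, with the missing mass `1 - ∑ w k` placed at `0`. The bound is
independent of the number of sets, where a union bound would cost a `log n`. -/
theorem lintegral_uniformSphere_exp_sum_le {n : ℕ} (hn : 1 ≤ n)
    (u : OrthonormalBasis (Fin n) ℝ (Vec n)) {ι : Type*} (K : Finset ι) (S : ι → Finset (Fin n))
    {w : ι → ℝ} (hw : ∀ k, 0 ≤ w k) (hw1 : ∑ k ∈ K, w k ≤ 1) :
    ∫⁻ g : Metric.sphere (0 : Vec n) 1,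
        ENNReal.ofReal (exp (√n / 4 * ∑ k ∈ K, w k * |weightDev u (S k) g|)) ∂uniformSphere n ≤
      ENNReal.ofReal (exp 1) := by
  have : NeZero n := ⟨by omega⟩
  have hm := fun k => measurable_weightDev u (S k)
  have hv : 0 ≤ 1 - ∑ k ∈ K, w k := by linarith
  calc ∫⁻ g : Metric.sphere (0 : Vec n) 1,
        ENNReal.ofReal (exp (√n / 4 * ∑ k ∈ K, w k * |weightDev u (S k) g|)) ∂uniformSphere n
      ≤ ∫⁻ g : Metric.sphere (0 : Vec n) 1, (ENNReal.ofReal (1 - ∑ k ∈ K, w k) +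
          ∑ k ∈ K, ENNReal.ofReal (w k) * ENNReal.ofReal (exp (√n / 4 * |weightDev u (S k) g|)))
            ∂uniformSphere n := by
        refine lintegral_mono fun g => ?_
        have h := convexOn_exp.map_add_sum_le (t := K) (w := w) (v := 1 - ∑ k ∈ K, w k) (q := 0)
          (p := fun k => √n / 4 * |weightDev u (S k) (g : Vec n)|) (fun k _ => hw k) (by ring)
          (by simp) hv (by simp)
        simp only [smul_eq_mul, mul_zero, zero_add, exp_zero, mul_one] at h
        have e : √n / 4 * ∑ k ∈ K, w k * |weightDev u (S k) (g : Vec n)| =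
            ∑ k ∈ K, w k * (√n / 4 * |weightDev u (S k) (g : Vec n)|) := by
          rw [Finset.mul_sum]
          exact Finset.sum_congr rfl fun k _ => by ring
        rw [e]
        refine (ENNReal.ofReal_le_ofReal h).trans_eq ?_
        rw [ENNReal.ofReal_add hv (Finset.sum_nonneg fun k _ => mul_nonneg (hw k) (exp_pos _).le),
          ENNReal.ofReal_sum_of_nonneg fun k _ => mul_nonneg (hw k) (exp_pos _).le]
        simp_rw [ENNReal.ofReal_mul (hw _)]
    _ = ENNReal.ofReal (1 - ∑ k ∈ K, w k) + ∑ k ∈ K, ENNReal.ofReal (w k) *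
          ∫⁻ g : Metric.sphere (0 : Vec n) 1,
            ENNReal.ofReal (exp (√n / 4 * |weightDev u (S k) g|)) ∂uniformSphere n := by
        rw [lintegral_add_left measurable_const, lintegral_const, measure_univ, mul_one,
          lintegral_finsetSum _ (fun k _ => by have := hm k; fun_prop)]
        congr 1
        refine Finset.sum_congr rfl fun k _ => ?_
        rw [lintegral_const_mul' _ _ ENNReal.ofReal_ne_top]
    _ ≤ ENNReal.ofReal (1 - ∑ k ∈ K, w k) + ∑ k ∈ K, ENNReal.ofReal (w k) *
          ENNReal.ofReal (exp 1) := by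
        gcongr with k
        exact (lintegral_uniformSphere_exp_abs_weightDev_le hn u (S k)).trans
          (ENNReal.ofReal_le_ofReal two_mul_exp_quarter_le)
    _ ≤ ENNReal.ofReal (exp 1) := by
        rw [← Finset.sum_mul, ← ENNReal.ofReal_sum_of_nonneg fun k _ => hw k,
          ← ENNReal.ofReal_mul (Finset.sum_nonneg fun k _ => hw k), ← ENNReal.ofReal_add hv
          (mul_nonneg (Finset.sum_nonneg fun k _ => hw k) (exp_pos _).le)]
        refine ENNReal.ofReal_le_ofReal ?_
        have h1 : 1 ≤ exp 1 := one_le_exp zero_le_one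
        nlinarith [mul_nonneg hv (sub_nonneg.2 h1)]

/-- Tail bound for weighted sums of weight deviations. -/
theorem le_uniformSphere_sum_weightDev_le {n : ℕ} (hn : 1 ≤ n)
    (u : OrthonormalBasis (Fin n) ℝ (Vec n)) {ι : Type*} (K : Finset ι) (S : ι → Finset (Fin n))
    {d : ι → ℝ} (hd : ∀ k, 0 ≤ d k) {D : ℝ} (hD : 0 < D) (hdD : ∑ k ∈ K, d k ≤ D) {δ : ℝ}
    (hδ : 0 < δ) :
    ENNReal.ofReal (1 - δ) ≤ uniformSphere n {g : Metric.sphere (0 : Vec n) 1 |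
      ∑ k ∈ K, d k * |weightDev u (S k) g| ≤ D * (4 / √n) * (1 + log (1 / δ))} := by
  have : NeZero n := ⟨by omega⟩
  have hm := fun k => measurable_weightDev u (S k)
  have hn' : (0 : ℝ) < n := by exact_mod_cast hn
  have hs : 0 < √(n : ℝ) := sqrt_pos.2 hn'
  let f : Metric.sphere (0 : Vec n) 1 → ENNReal := fun g =>
    ENNReal.ofReal (exp (√n / 4 * ∑ k ∈ K, d k / D * |weightDev u (S k) g|))
  have hfm : Measurable f := by
    have : ∀ k, Measurable fun g : Metric.sphere (0 : Vec n) 1 => weightDev u (S k) (g : Vec n) :=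
      fun k => (hm k).comp measurable_subtype_coe
    fun_prop
  have h1 : ∫⁻ g, f g ∂uniformSphere n ≤ ENNReal.ofReal (exp 1) :=
    lintegral_uniformSphere_exp_sum_le hn u K S (fun k => div_nonneg (hd k) hD.le)
      (by rw [← Finset.sum_div]; exact (div_le_one hD).2 hdD)
  have hc : ENNReal.ofReal (exp 1 / δ) ≠ 0 := by
    rw [Ne, ENNReal.ofReal_eq_zero, not_le]
    positivity
  -- Markov's inequality at level `e / δ`, against an integral of at most `e`.
  have h2 : uniformSphere n {g | ENNReal.ofReal (exp 1 / δ) ≤ f g} ≤ ENNReal.ofReal δ := by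
    refine (meas_ge_le_lintegral_div hfm.aemeasurable hc ENNReal.ofReal_ne_top).trans ?_
    refine (ENNReal.div_le_div_right h1 _).trans ?_
    rw [← ENNReal.ofReal_div_of_pos (by positivity)]
    refine ENNReal.ofReal_le_ofReal (le_of_eq ?_)
    field_simp
  have h3 : {g | ENNReal.ofReal (exp 1 / δ) ≤ f g}ᶜ ⊆ {g : Metric.sphere (0 : Vec n) 1 |
      ∑ k ∈ K, d k * |weightDev u (S k) g| ≤ D * (4 / √n) * (1 + log (1 / δ))} := by
    intro g hg
    simp only [Set.mem_compl_iff, Set.mem_ofPred_eq, not_le, f] at hg ⊢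
    have h4 : exp 1 / δ = exp (1 + log (1 / δ)) := by
      rw [exp_add, exp_log (by positivity)]
      ring
    rw [ENNReal.ofReal_lt_ofReal_iff (by positivity), h4, exp_lt_exp] at hg
    have h5 : √n / 4 * ∑ k ∈ K, d k / D * |weightDev u (S k) (g : Vec n)| =
        (∑ k ∈ K, d k * |weightDev u (S k) (g : Vec n)|) / (D * (4 / √n)) := by
      simp only [div_mul_eq_mul_div, ← Finset.sum_div]
      field_simp
    rw [h5, div_lt_iff₀ (by positivity)] at hg
    linarith
  refine le_trans ?_ (measure_mono h3)
  rw [prob_compl_eq_one_sub (measurableSet_le measurable_const hfm), ENNReal.ofReal_sub _ hδ.le,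
    ENNReal.ofReal_one]
  exact tsub_le_tsub_left h2 1

/-- The Wasserstein error of Lanczos quadrature is controlled by weight deviations and a
deterministic term. -/
theorem exists_W1_spectralDensity_slq_le {n : ℕ} {A : Matrix (Fin n) (Fin n) ℝ}
    (hA : A.IsHermitian) :
    ∃ (S : ℕ → Finset (Fin n)) (d : ℕ → ℝ), (∀ k, 0 ≤ d k) ∧
      ∑ k ∈ Finset.range (n - 1), d k ≤ 2 * specNorm A ∧
      ∀ (m : ℕ) [NeZero m], 2 ≤ m → ∀ g : Vec n, ‖g‖ = 1 →
        W1 (spectralDensity hA) ((slq m g).output A) ≤ ENNReal.ofReal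
          (2 * π / m * specNorm A + ∑ k ∈ Finset.range (n - 1),
            d k * |weightDev hA.eigenvectorBasis (S k) g|) := by
  have hl : ∀ i, |hA.eigenvalues i| ≤ specNorm A :=
    abs_eigenvalues_le hA (abs_inner_matVec_le A)
  obtain ⟨S, d, hd, hdR, hS⟩ := exists_sum_mul_lipschitz_le hA.eigenvalues (specNorm_nonneg A) hl
  refine ⟨S, d, hd, hdR, fun m _ hm g hg => iSup₂_le fun h hh => ENNReal.ofReal_le_ofReal ?_⟩
  rw [slq, Program.output_map, output_lanczos, integral_quadrature, integral_spectralDensity]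
  obtain ⟨p, hpm, hp⟩ := exists_polynomial_abs_sub_le_mul hm hh (specNorm_nonneg A)
  have hn : (n : ℝ) ≠ 0 := by
    rintro hn
    have : n = 0 := by exact_mod_cast hn
    subst this
    simp [Subsingleton.elim g 0] at hg
  have hw1 := sum_inner_eigenvectorBasis_sq hA g
  rw [hg, one_pow] at hw1
  have h1 := hS (fun i => inner ℝ (hA.eigenvectorBasis i) g ^ 2 - 1 / n)
    (by simp [Finset.sum_sub_distrib, hw1, hn]) h hh
  have h2 := sum_eigenvalues_tridiag_eval hA g m hg p hpm
  have h3 := sum_eigenvectorBasis_apply_sq m (tridiag_isHermitian fun i : Fin m => lanczosSeq A g i)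
  -- Used for the quadrature and for the spectral measure of `g`. Their polynomial integrals agree
  -- by `h2`, so the total approximation error is twice this one.
  have approx : ∀ {k : ℕ} (w l : Fin k → ℝ), (∀ i, 0 ≤ w i) → ∑ i, w i = 1 →
      (∀ i, |l i| ≤ specNorm A) →
      |∑ i, w i * h (l i) - ∑ i, w i * p.eval (l i)| ≤ specNorm A * (π / m) := by
    intro k w l hw hw1 hl
    rw [← Finset.sum_sub_distrib]
    calc |∑ i, (w i * h (l i) - w i * p.eval (l i))|
        ≤ ∑ i, |w i * h (l i) - w i * p.eval (l i)| := Finset.abs_sum_le_sum_abs _ _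
      _ ≤ ∑ i, w i * (specNorm A * (π / m)) := by
          refine Finset.sum_le_sum fun i _ => ?_
          rw [← mul_sub, abs_mul, abs_of_nonneg (hw i)]
          exact mul_le_mul_of_nonneg_left (hp _ (hl i)) (hw i)
      _ = _ := by rw [← Finset.sum_mul, hw1, one_mul]
  have h4 := approx _ _ (fun _ => sq_nonneg _) h3 (abs_eigenvalues_tridiag_le hA g m)
  have h5 := approx _ _ (fun _ => sq_nonneg _) hw1 hl
  rw [h2] at h4
  simp only [sub_mul, Finset.sum_sub_distrib] at h1
  have e : 2 * π / m * specNorm A = 2 * (specNorm A * (π / m)) := by ring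
  rw [e]
  have h1' := abs_le.1 h1
  have h4' := abs_le.1 h4
  have h5' := abs_le.1 h5
  simp only [weightDev, Finset.sum_sub_distrib] at h1' ⊢
  linarith [h1'.1, h4'.1, h5'.2]

end Transport

end SLQ

/-! ### Choice of constants and conclusion -/

theorem mainTheorem9 :
    ∃ c : ℝ, 0 < c ∧
    ∀ ε₀ : ℝ, 0 < ε₀ → ε₀ < 1 →
    ∃ C : ℝ, 0 < C ∧
    ∀ (n : ℕ), 1 ≤ n →
    ∀ (A : Matrix (Fin n) (Fin n) ℝ) (hA : A.IsHermitian)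
      (ε δ : ℝ), 0 < ε → ε ≤ ε₀ → 0 < δ → δ < 1 →
    ∀ (m : ℕ) [NeZero m], c / ε ≤ (m : ℝ) →
      (∀ g : Metric.sphere (0 : SLQ.Vec n) 1,
        (SLQ.slq m (g : SLQ.Vec n)).numQueries A = m) ∧
      ENNReal.ofReal (1 - δ) ≤
        SLQ.uniformSphere n {g : Metric.sphere (0 : SLQ.Vec n) 1 |
          SLQ.W1 (SLQ.spectralDensity hA) ((SLQ.slq m (g : SLQ.Vec n)).output A) ≤
            ENNReal.ofReal
              (ε * SLQ.specNorm A +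
                C * Real.log (1 / (ε * δ)) * Real.log (1 / ε) / Real.sqrt n * SLQ.specNorm A)} := by
  refine ⟨2 * Real.pi, by positivity, fun ε₀ hε₀ hε₀1 => ?_⟩
  set L := Real.log (1 / ε₀)
  have hL : 0 < L := Real.log_pos ((one_lt_div hε₀).2 hε₀1)
  have hmin : 0 < min 1 L := lt_min one_pos hL
  -- The `8` is the total gap `2‖A‖` times the scale `4/√n`. One factor `L` is paid for by `log
  -- (1/ε) ≥ L`; `min 1 L` lets `log (1/ε) + log (1/δ)` absorb `1 + log (1/δ)`.
  refine ⟨8 / (L * min 1 L), by positivity, ?_⟩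
  intro n hn A hA ε δ hε hεε₀ hδ hδ1 m _ hm
  refine ⟨fun g => SLQ.numQueries_slq A m g, ?_⟩
  have : NeZero n := ⟨by omega⟩
  have hm0 : (0 : ℝ) < m := by exact_mod_cast Nat.pos_of_ne_zero (NeZero.ne m)
  have hmε : 2 * Real.pi / m ≤ ε := by
    rw [div_le_iff₀ hε] at hm
    rw [div_le_iff₀ hm0]
    linarith
  have hm2 : 2 ≤ m := by
    rw [div_le_iff₀ hε] at hm
    have h2 : (2 : ℝ) < m := by nlinarith [Real.pi_gt_three]
    exact_mod_cast h2.le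
  have hR := SLQ.specNorm_nonneg A
  obtain ⟨S, d, hd, hdR, hW⟩ := SLQ.exists_W1_spectralDensity_slq_le hA
  have hlε : L ≤ Real.log (1 / ε) :=
    Real.log_le_log (by positivity) (one_div_le_one_div_of_le hε hεε₀)
  have hlδ : 0 < Real.log (1 / δ) := Real.log_pos ((one_lt_div hδ).2 hδ1)
  have hlog : 1 + Real.log (1 / δ) ≤
      Real.log (1 / (ε * δ)) * Real.log (1 / ε) / (L * min 1 L) := by
    have h1 : Real.log (1 / (ε * δ)) = Real.log (1 / ε) + Real.log (1 / δ) := by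
      rw [← Real.log_mul (by positivity) (by positivity)]
      congr 1
      field_simp
    rw [le_div_iff₀ (by positivity), h1]
    have h2 : (1 + Real.log (1 / δ)) * min 1 L ≤ Real.log (1 / ε) + Real.log (1 / δ) := by
      nlinarith [min_le_left 1 L, min_le_right 1 L]
    have h3 : 0 ≤ Real.log (1 / ε) + Real.log (1 / δ) := by linarith
    calc (1 + Real.log (1 / δ)) * (L * min 1 L) = (1 + Real.log (1 / δ)) * min 1 L * L := by ring
      _ ≤ (Real.log (1 / ε) + Real.log (1 / δ)) * Real.log (1 / ε) := by gcongr
  have key : ∀ g : Metric.sphere (0 : SLQ.Vec n) 1,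
      ∑ k ∈ Finset.range (n - 1), d k * |SLQ.weightDev hA.eigenvectorBasis (S k) g| ≤
        2 * SLQ.specNorm A * (4 / Real.sqrt n) * (1 + Real.log (1 / δ)) →
      SLQ.W1 (SLQ.spectralDensity hA) ((SLQ.slq m (g : SLQ.Vec n)).output A) ≤
        ENNReal.ofReal (ε * SLQ.specNorm A + 8 / (L * min 1 L) * Real.log (1 / (ε * δ)) *
          Real.log (1 / ε) / Real.sqrt n * SLQ.specNorm A) := by
    intro g hg
    refine (hW m hm2 g (by simp)).trans (ENNReal.ofReal_le_ofReal (add_le_add ?_ (hg.trans ?_)))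
    · gcongr
    · calc 2 * SLQ.specNorm A * (4 / Real.sqrt n) * (1 + Real.log (1 / δ)) ≤
            2 * SLQ.specNorm A * (4 / Real.sqrt n) *
              (Real.log (1 / (ε * δ)) * Real.log (1 / ε) / (L * min 1 L)) := by gcongr
        _ = _ := by ring
  -- The tail bound needs a positive total. If `‖A‖ = 0`, all gaps vanish and the estimate holds for
  -- every `g`.
  rcases hR.eq_or_lt with hR0 | hR0
  · have hd0 : ∑ k ∈ Finset.range (n - 1), d k = 0 :=
      le_antisymm (by rw [← hR0] at hdR; simpa using hdR) (Finset.sum_nonneg fun k _ => hd k)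
    have hd0' := (Finset.sum_eq_zero_iff_of_nonneg fun k _ => hd k).1 hd0
    refine le_trans ?_ (measure_mono (s := Set.univ) fun g _ => key g ?_)
    · rw [measure_univ]
      exact ENNReal.ofReal_le_one.2 (by linarith)
    · rw [Finset.sum_eq_zero fun k hk => by rw [hd0' k hk, zero_mul], ← hR0]
      simp
  · exact (SLQ.le_uniformSphere_sum_weightDev_le hn hA.eigenvectorBasis _ S hd
      (by positivity) hdR hδ).trans (measure_mono key)
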